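/- **Hybrid systems.** Let $n,m\ge 0$ and consider a hybrid dynamical system $\mathcal H$ consisting of: a finite set $\mathcal J$ of modes; a set $\Gamma\subset\mathcal J\times\mathcal J$ of edges; for each $j\in\mathcal J$ a domain $D_j\subset\mathbb R^n$ that is a connected smooth embedded $n$-manifold with boundary, with (manifold) boundary $\partial D_j\subset D_j$; a compact set $U\subset\mathbb R^m$ of inputs; vector fields $f_j:\mathbb R^n\times U\to\mathbb R^n$, smooth, and Lipschitz in $x$ uniformly in $u\in U$; and, for each $e=(j,j')\in\Gamma$, a guard $G_e\subset\partial D_j$ that is a smooth embedded $(n-1)$-manifold and a reset map $R_e:\mathbb R^n\to\mathbb R^n$ with $R_e(G_e)\subset\partial D_{j'}$. Assume: 1. For each $e=(j,j')\in\Gamma$ there are given unit vectors $\hat g_e,\hat r_e\in\mathbb R^n$ and scalars $c_e,d_e$ such that, with $g_e(x)=\hat g_e^Tx-c_e$ and $r_e(x)=\hat r_e^Tx-d_e$, one has $g_e=0$ on $G_e$, $R_e(\{g_e=0\})\subset\{r_e=0\}$, $g_e<0$ on $D_j\setminus G_e$ and $r_e>0$ on $D_{j'}\setminus R_e(G_e)$.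 2. Each $R_e$ is a diffeomorphism of $\mathbb R^n$, and $\nabla R_e$, $\nabla (R_e^{-1})$ are globally Lipschitz. 3. The sets $G_e$ and $R_e(G_e)$, $e\in\Gamma$, viewed inside the disjoint union $\coprod_j D_j$, are mutually disjoint, and every point of every $\partial D_j$ lies in one of those of them that are contained in $D_j$. **The space $\mathcal M$.** Let $\mathcal M$ be the quotient of $\coprod_{j}D_j$ by the smallest equivalence relation that identifies each $x\in G_e\subset D_j$ with $R_e(x)\in D_{j'}$ for every $e=(j,j')\in\Gamma$, let it carry the quotient topology, and let $\pi_j:D_j\to\mathcal M$ be the canonical maps. For $e=(j,j')\in\Gamma$ put $$\bar R_e(x)=R_e\bigl(x-\hat g_e\,g_e(x)\bigr)+\hat r_e\,g_e(x),\qquad D_{j',e}=\bar R_e^{-1}(D_{j'}),\qquad \hat D_e=\mathrm{int}(D_j)\cup G_e\cup\mathrm{int}(D_{j',e}),$$ and let $\pi_e:\hat D_e\to\mathcal M$ equal $\pi_j$ on $D_j$ and $\pi_{j'}\circ\bar R_e$ on $D_{j',e}$. The maps $\pi_e$ serve as (inverse) charts of $\mathcal M$. If $j$ is not an endpoint of any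 edge, $\pi_j:D_j\to\mathcal M$ is used as an additional chart. Let $d$ be a metric on $\mathcal M$ that induces the quotient topology and for which the coordinate maps (the local inverses of the charts $\pi_e$ and of the additional charts $\pi_j$) are locally Lipschitz. **Filippov solutions.** For $e=(j,j')\in\Gamma$ and $u\in U$ let $f_e(x,u)=f_j(x,u)$ for $x\in\mathrm{int}(D_j)$ and $f_e(x,u)=(\nabla\bar R_e(x))^{-1}f_{j'}(\bar R_e(x),u)$ for $x\in\mathrm{int}(D_{j',e})$, and for $x\in\hat D_e$ let $$\mathcal F[f_e](x,u)=\bigcap_{\delta>0}\ \bigcap_{\mu(S)=0}\overline{\mathrm{co}}\;f_e\bigl((B^\delta(x)\cap\hat D_e)\setminus S,\,u\bigr),$$ where $\mu$ is Lebesgue measure. For an additional chart $\pi_j$, use $f_j$ and $D_j$ in place of $f_e$ and $\hat D_e$. Let $T\ge 0$, $X_0\in\mathcal M$, and let $u:[0,T]\to U$ be piecewise continuous (continuous off a finite set, with one-sided limits everywhere). A *hybrid Filippov solution* for the data $(X_0,u)$ is a curve $X:[0,T]\to\mathcal M$, absolutely continuous with respect to $d$, with $X(0)=X_0$, such that in every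 chart $$\dot X(t)\in D\pi_e\bigl(\mathcal F[f_e](x,u(t))\bigr)\quad\text{where }\pi_e(x)=X(t),\qquad\text{for a.e. }t\in[0,T]\text{ with }X(t)\in\pi_e(\hat D_e);$$ that is, the local lift of $X$ through $\pi_e$ that is at $x$ at time $t$ has at $t$ a derivative belonging to $\mathcal F[f_e](x,u(t))$. **Theorem.** Assume the hybrid transversality condition: for each $e=(j,j')\in\Gamma$ and each $(x,u)\in G_e\times U$, either $\hat g_e^Tf_j(x,u)>0$ or $\hat r_e^Tf_{j'}(R_e(x),u)<0$. If $X:[0,T]\to\mathcal M$ is a hybrid Filippov solution for the data $(X_0,u)\in\mathcal M\times PC([0,T],U)$, then $X$ is the unique hybrid Filippov solution for these data: every hybrid Filippov solution $Y:[0,T]\to\mathcal M$ for $(X_0,u)$ satisfies $Y(t)=X(t)$ for all $t\in[0,T]$. -/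

import Mathlib

open Set Filter Topology MeasureTheory
open scoped ContDiff NNReal

/-- The Euclidean space `ℝⁿ`. -/
abbrev Eu (n : ℕ) : Type := EuclideanSpace ℝ (Fin n)

/-! ### Smooth domains and hypersurfaces in `ℝⁿ` -/

/-- `D ⊆ ℝⁿ` is a smooth embedded `n`-manifold with boundary: near each of its points it is either
all of `ℝⁿ` or the sublevel set `{h ≤ 0}` of a smooth function that is regular at that point. -/
def IsSmoothDomain {n : ℕ} (D : Set (Eu n)) : Prop :=
  ∀ p ∈ D, p ∈ interior D ∨
    ∃ (W : Set (Eu n)) (h : Eu n → ℝ), IsOpen W ∧ p ∈ W ∧ ContDiffOn ℝ ∞ h W ∧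
      h p = 0 ∧ fderiv ℝ h p ≠ 0 ∧ ∀ x ∈ W, (x ∈ D ↔ h x ≤ 0)

/-- `G ⊆ ℝⁿ` is a smooth embedded `(n-1)`-manifold: near each of its points it is the zero set of
a smooth function that is regular at that point. -/
def IsSmoothHypersurface {n : ℕ} (G : Set (Eu n)) : Prop :=
  ∀ p ∈ G, ∃ (W : Set (Eu n)) (h : Eu n → ℝ), IsOpen W ∧ p ∈ W ∧ ContDiffOn ℝ ∞ h W ∧
    h p = 0 ∧ fderiv ℝ h p ≠ 0 ∧ ∀ x ∈ W, (x ∈ G ↔ h x = 0)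

/-- The manifold boundary `∂D` of a smooth `n`-dimensional domain `D ⊆ ℝⁿ`: the points of `D` on
its topological frontier (for closed `D` this is the whole frontier). -/
def mfdBoundary {n : ℕ} (D : Set (Eu n)) : Set (Eu n) := D ∩ frontier D

/-! ### Hybrid dynamical systems -/

/-- A hybrid dynamical system with modes `J`, continuous states in `ℝⁿ` and inputs in `ℝᵐ`,
together with the normal forms `g_e(x) = ⟪ĝ_e, x⟫ - c_e` and `r_e(x) = ⟪r̂_e, x⟫ - d_e` used to
describe the guards and their images under the resets. Only the values of `G`, `R`, `ghat`, `c`,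
`rhat`, `d` at edges `e ∈ Γ` play a role. -/
structure HybridSystem (J : Type*) (n m : ℕ) where
  /-- edges -/
  Γ : Set (J × J)
  /-- domains -/
  D : J → Set (Eu n)
  /-- allowable inputs -/
  U : Set (Eu m)
  /-- vector fields; only their restrictions to `ℝⁿ × U` play a role -/
  f : J → Eu n → Eu m → Eu n
  /-- guards -/
  G : J × J → Set (Eu n)
  /-- reset maps -/
  R : J × J → Eu n → Eu n
  ghat : J × J → Eu n
  c : J × J → ℝ
  rhat : J × J → Eu n
  d : J × J → ℝ
  domain_smooth : ∀ j, IsSmoothDomain (D j)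
  domain_connected : ∀ j, IsConnected (D j)
  inputs_compact : IsCompact U
  guard_smooth : ∀ e ∈ Γ, IsSmoothHypersurface (G e)
  guard_boundary : ∀ e ∈ Γ, G e ⊆ mfdBoundary (D e.1)
  reset_boundary : ∀ e ∈ Γ, R e '' G e ⊆ mfdBoundary (D e.2)

namespace HybridSystem

variable {J : Type*} {n m : ℕ} (H : HybridSystem J n m)

/-- `g_e(x) = ĝ_eᵀ x - c_e` -/
noncomputable def g (e : J × J) (x : Eu n) : ℝ := inner ℝ (H.ghat e) x - H.c e

/-- `r_e(x) = r̂_eᵀ x - d_e` -/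
noncomputable def r (e : J × J) (x : Eu n) : ℝ := inner ℝ (H.rhat e) x - H.d e

/-- The standing assumptions on the hybrid systems under consideration. -/
structure Standing : Prop where
  /-- Each `f_j` is smooth on `ℝⁿ × U`. -/
  field_smooth : ∀ j, ContDiffOn ℝ ∞ (fun q : Eu n × Eu m => H.f j q.1 q.2) (univ ×ˢ H.U)
  /-- Each `f_j` is globally Lipschitz in the state, uniformly in the input. -/
  field_lipschitz : ∀ j, ∃ K : ℝ≥0, ∀ v ∈ H.U, LipschitzWith K (fun x => H.f j x v)
  ghat_unit : ∀ e ∈ H.Γ, ‖H.ghat e‖ = 1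
  rhat_unit : ∀ e ∈ H.Γ, ‖H.rhat e‖ = 1
  /-- The guard lies in the hyperplane `{g_e = 0}`. -/
  guard_affine : ∀ e ∈ H.Γ, ∀ x ∈ H.G e, H.g e x = 0
  /-- The reset maps the hyperplane `{g_e = 0}` into the hyperplane `{r_e = 0}`. -/
  reset_affine : ∀ e ∈ H.Γ, ∀ x, H.g e x = 0 → H.r e (H.R e x) = 0
  guard_side : ∀ e ∈ H.Γ, ∀ x ∈ H.D e.1 \ H.G e, H.g e x < 0
  reset_side : ∀ e ∈ H.Γ, ∀ x ∈ H.D e.2 \ H.R e '' H.G e, 0 < H.r e x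
  /-- Each `R_e` is a diffeomorphism of `ℝⁿ`; the derivatives of `R_e` and of its inverse are
  globally Lipschitz. -/
  reset_diffeo : ∀ e ∈ H.Γ, ContDiff ℝ ∞ (H.R e) ∧ (∃ K : ℝ≥0, LipschitzWith K (fderiv ℝ (H.R e))) ∧
    ∃ S : Eu n → Eu n, Function.LeftInverse S (H.R e) ∧ Function.RightInverse S (H.R e) ∧
      ContDiff ℝ ∞ S ∧ ∃ K : ℝ≥0, LipschitzWith K (fderiv ℝ S)
  /-- The guards and the images of the guards, each seen as a subset of its own domain inside the
  disjoint union of the domains, are mutually disjoint. -/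
  guards_disjoint : ∀ e ∈ H.Γ, ∀ e' ∈ H.Γ, e ≠ e' → e.1 = e'.1 → Disjoint (H.G e) (H.G e')
  images_disjoint : ∀ e ∈ H.Γ, ∀ e' ∈ H.Γ, e ≠ e' → e.2 = e'.2 →
    Disjoint (H.R e '' H.G e) (H.R e' '' H.G e')
  guard_image_disjoint : ∀ e ∈ H.Γ, ∀ e' ∈ H.Γ, e.1 = e'.2 → Disjoint (H.G e) (H.R e' '' H.G e')
  /-- Every boundary point of a domain lies in a guard or in the image of a guard. -/
  boundary_covered : ∀ j, ∀ x ∈ mfdBoundary (H.D j), ∃ e ∈ H.Γ,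
    (e.1 = j ∧ x ∈ H.G e) ∨ (e.2 = j ∧ x ∈ H.R e '' H.G e)

/-- The hybrid transversality condition. -/
def Transverse : Prop :=
  ∀ e ∈ H.Γ, ∀ x ∈ H.G e, ∀ v ∈ H.U,
    0 < inner ℝ (H.ghat e) (H.f e.1 x v) ∨ inner ℝ (H.rhat e) (H.f e.2 (H.R e x) v) < 0

/-! ### The hybrid quotient space -/

/-- The relation on the disjoint union of the domains that relates `x ∈ G_e` to `R_e(x)`. -/
def Glue (a b : Σ j, ↥(H.D j)) : Prop :=
  ∃ e ∈ H.Γ, a.1 = e.1 ∧ b.1 = e.2 ∧ (a.2 : Eu n) ∈ H.G e ∧ (b.2 : Eu n) = H.R e (a.2 : Eu n)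

/-- The hybrid quotient space `𝓜`: the quotient of the disjoint union of the domains by the
smallest equivalence relation containing `Glue`. -/
def Space : Type _ := Quot H.Glue

/-- The quotient topology on `𝓜`. -/
@[reducible] def quotientTopology : TopologicalSpace H.Space :=
  inferInstanceAs (TopologicalSpace (Quot H.Glue))

/-- `π_j : D_j → 𝓜` -/
def modeMap (j : J) (x : ↥(H.D j)) : H.Space := Quot.mk H.Glue ⟨j, x⟩

/-- `R̄_e(x) = R_e(p_e(x)) + r̂_e g_e(x)`, with `p_e(x) = x - ĝ_e g_e(x)`. -/
noncomputable def Rbar (e : J × J) (x : Eu n) : Eu n :=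
  H.R e (x - H.g e x • H.ghat e) + H.g e x • H.rhat e

/-- `D_{j',e} = R̄_e⁻¹(D_{j'})` for `e = (j,j')` -/
def attached (e : J × J) : Set (Eu n) := H.Rbar e ⁻¹' H.D e.2

/-- `D̂_e = int(D_j) ∪ G_e ∪ int(D_{j',e})` for `e = (j,j')` -/
def edgeDomain (e : J × J) : Set (Eu n) :=
  interior (H.D e.1) ∪ H.G e ∪ interior (H.attached e)

theorem mem_of_mem_edgeDomain (e : ↥H.Γ) {x : Eu n} (hx : x ∈ H.edgeDomain e)
    (hD : x ∉ H.D e.1.1) : H.Rbar e x ∈ H.D e.1.2 := by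
  rcases hx with (hx | hx) | hx
  · exact absurd (interior_subset hx) hD
  · exact absurd (H.guard_boundary e.1 e.2 hx).1 hD
  · exact (interior_subset hx : x ∈ H.attached e.1)

open Classical in
/-- `π_e : D̂_e → 𝓜`, equal to `π_j` on `D_j` and to `π_{j'} ∘ R̄_e` on `D_{j',e}`. -/
noncomputable def edgeMap (e : ↥H.Γ) (x : ↥(H.edgeDomain e)) : H.Space :=
  if h : (x : Eu n) ∈ H.D e.1.1 then H.modeMap e.1.1 ⟨x, h⟩
  else H.modeMap e.1.2 ⟨H.Rbar e x, H.mem_of_mem_edgeDomain e x.2 h⟩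

open Classical in
/-- `f_e`, equal to `f_j` on `int(D_j)` and to `(∇R̄_e(x))⁻¹ f_{j'}(R̄_e(x), u)` on
`int(D_{j',e})`. Its values elsewhere are immaterial. -/
noncomputable def edgeField (e : J × J) (x : Eu n) (v : Eu m) : Eu n :=
  if x ∈ interior (H.D e.1) then H.f e.1 x v
  else if x ∈ interior (H.attached e) then
    (fderiv ℝ (H.Rbar e) x).inverse (H.f e.2 (H.Rbar e x) v)
  else 0

/-- A mode that is not an endpoint of any edge. Its domain is (under the standing assumptions) an
open set that meets none of the `π_e(D̂_e)`; the map `π_j` itself serves as its chart. -/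
def Isolated (j : J) : Prop := ∀ e ∈ H.Γ, e.1 ≠ j ∧ e.2 ≠ j

end HybridSystem

/-! ### Filippov solutions -/

/-- The Filippov regularization at `(x, v)` of a field `f` given on `V × U`, `V ⊆ ℝⁿ`:
the intersection over `δ > 0` and Lebesgue-null sets `S` of the closed convex hulls of
`f (B^δ(x) ∖ S, v)`. -/
def filippovReg {n m : ℕ} (V : Set (Eu n)) (f : Eu n → Eu m → Eu n) (x : Eu n) (v : Eu m) :
    Set (Eu n) :=
  ⋂ (δ : ℝ) (_ : 0 < δ) (S : Set (Eu n)) (_ : volume S = 0),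
    closure (convexHull ℝ ((fun y => f y v) '' ((Metric.ball x δ ∩ V) \ S)))

/-- `X : ℝ → M` has velocity `Dφ(x) w` at time `t`, where `φ : V → M` is an inverse chart,
`φ(x) = X(t)` and `w` is a coordinate vector: the lift of `X` through `φ` that is at `x` at time
`t` has derivative `w` there. -/
def HasChartVelocity {n : ℕ} {M : Type*} {V : Set (Eu n)} (φ : V → M) (X : ℝ → M) (t : ℝ)
    (x w : Eu n) : Prop :=
  ∃ y : ℝ → Eu n, y t = x ∧ (∀ᶠ s in 𝓝 t, ∃ h : y s ∈ V, φ ⟨y s, h⟩ = X s) ∧ HasDerivAt y w t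

/-- In the inverse chart `φ : V → M`, the curve `X` satisfies the Filippov inclusion
`Ẋ(t) ∈ Dφ (𝓕[f](x, u(t)))`, `φ(x) = X(t)`, for almost every `t ∈ [0,T]` with `X(t) ∈ φ(V)`. -/
def SatisfiesInChart {n m : ℕ} {M : Type*} {V : Set (Eu n)} (φ : V → M)
    (f : Eu n → Eu m → Eu n) (T : ℝ) (u : ℝ → Eu m) (X : ℝ → M) : Prop :=
  ∀ᵐ t : ℝ, t ∈ Ioo 0 T → ∀ x : V, φ x = X t →
    ∃ w ∈ filippovReg V f x (u t), HasChartVelocity φ X t x w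

/-- `u ∈ PC([0,T], U)`: `u` takes values in `U` on `[0,T]`, is continuous there off a finite set,
and has one-sided limits. -/
structure IsPiecewiseContinuous {m : ℕ} (T : ℝ) (U : Set (Eu m)) (u : ℝ → Eu m) : Prop where
  mem : ∀ t ∈ Icc 0 T, u t ∈ U
  continuous_off_finite : ∃ S : Set ℝ, S.Finite ∧
    ∀ t ∈ Icc 0 T \ S, ContinuousWithinAt u (Icc 0 T) t
  right_limit : ∀ t ∈ Ico 0 T, ∃ l, Tendsto u (𝓝[>] t) (𝓝 l)
  left_limit : ∀ t ∈ Ioc 0 T, ∃ l, Tendsto u (𝓝[<] t) (𝓝 l)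

/-- The local inverses of `φ : V → M` (the coordinate maps) are locally Lipschitz. -/
def LocallyLipschitzCoordinates {n : ℕ} {M : Type*} [MetricSpace M] {V : Set (Eu n)}
    (φ : V → M) : Prop :=
  ∀ p : V, ∃ W ∈ 𝓝 p, ∃ C : ℝ, ∀ x ∈ W, ∀ y ∈ W, dist (x : Eu n) y ≤ C * dist (φ x) (φ y)

namespace HybridSystem

variable {J : Type*} {n m : ℕ} (H : HybridSystem J n m)

/-- The given metric on `𝓜` induces the quotient topology, and the coordinate maps `π_e⁻¹` of
`𝓜` are locally Lipschitz for it (so that curves that are absolutely continuous for the metric are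
absolutely continuous in coordinates). -/
structure IsStateMetric [MetricSpace H.Space] : Prop where
  topology_eq : (UniformSpace.toTopologicalSpace : TopologicalSpace H.Space) = H.quotientTopology
  edge_coordinates : ∀ e : ↥H.Γ, LocallyLipschitzCoordinates (H.edgeMap e)
  mode_coordinates : ∀ j, H.Isolated j → LocallyLipschitzCoordinates (H.modeMap j)

/-- `X : [0,T] → 𝓜` is a hybrid Filippov solution for the data `(X₀, u)`. -/
structure IsFilippovSolution [MetricSpace H.Space] (T : ℝ) (X₀ : H.Space) (u : ℝ → Eu m)
    (X : ℝ → H.Space) : Prop where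
  absolutelyContinuous : AbsolutelyContinuousOnInterval X 0 T
  initial : X 0 = X₀
  inclusion : ∀ e : ↥H.Γ, SatisfiesInChart (H.edgeMap e) (H.edgeField e) T u X
  inclusion_isolated : ∀ j, H.Isolated j → SatisfiesInChart (H.modeMap j) (H.f j) T u X

end HybridSystem

/-!
Two solutions agree on a closed set of times, so it is enough to show that if they agree at some
`t₀ < T`, they agree for some time after `t₀` (`HybridSystem.Standing.exists_eqOn_Icc`). Their
common position lies in the image of a chart, which is an open map
(`HybridSystem.Standing.edgeMap_image_mem_nhds`) with locally Lipschitz inverse. For a short time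
both solutions therefore lift to absolutely continuous curves in `ℝⁿ` that satisfy the Filippov
inclusion almost everywhere (`eqOn_of_satisfiesInChart`).

In coordinates the only discontinuity of the field is across the hyperplane `g_e = 0`: near a guard
the source domain is `{g_e ≤ 0}` and the attached domain is `{g_e ≥ 0}`, since a smooth hypersurface
contained in a hyperplane is relatively open in it. The fields on both sides extend to Lipschitz
fields `Q` (on `g_e < 0`) and `P` (on `g_e > 0`), and the Filippov set on the hyperplane is
contained in the segment between their values (`isSwitchingVelocity_of_mem_filippovReg`). The
derivative of `R̄_e` preserves normal components, so transversality says that at the starting point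
`Q` points strictly to the positive side or `P` points strictly to the negative side. By symmetry
only the first case matters.

Uniqueness in that case (`eqOn_of_transverse_field`) needs no regularity of the input beyond its
one-sided limit. The normal coordinate `s` of a solution starting on the hyperplane never becomes
negative. Hence `s` is minimal whenever it vanishes, and the velocity is then the tangent combination
`P + l (Q - P)`, with `l` comparable to the negative part of the normal component of `P`. For two
solutions `x`, `y` the difference of the velocities is bounded by `K ‖x - y‖` unless exactly one of
them is on the hyperplane. In that case there is an extra term of size `l`, but, up to a multiple of
`‖x - y‖`, `|s(x) - s(y)|` decreases at a rate comparable to `l`. So, for a suitable constant `C`,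
`‖x - y‖ + C |s(x) - s(y)|` satisfies a linear differential inequality and vanishes by Grönwall's
lemma.
-/

/-! ### Absolutely continuous functions -/

/-- Absolute continuity passes to a curve whose increments are dominated by those of `X`. -/
theorem AbsolutelyContinuousOnInterval.of_dist_le {M M' : Type*} [PseudoMetricSpace M]
    [PseudoMetricSpace M'] {X : ℝ → M} {y : ℝ → M'} {a b C : ℝ}
    (hX : AbsolutelyContinuousOnInterval X a b)
    (h : ∀ s ∈ uIcc a b, ∀ t ∈ uIcc a b, dist (y s) (y t) ≤ C * dist (X s) (X t)) :
    AbsolutelyContinuousOnInterval y a b := by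
  have h0 := Tendsto.const_mul C hX
  rw [mul_zero] at h0
  refine squeeze_zero' (Eventually.of_forall fun E => Finset.sum_nonneg fun _ _ => dist_nonneg)
    ?_ h0
  have : ∀ᶠ E in AbsolutelyContinuousOnInterval.totalLengthFilter ⊓
      𝓟 (AbsolutelyContinuousOnInterval.disjWithin a b),
      E ∈ AbsolutelyContinuousOnInterval.disjWithin a b :=
    mem_inf_of_right (mem_principal_self _)
  filter_upwards [this] with E hE
  rw [Finset.mul_sum]
  exact Finset.sum_le_sum fun i hi => h _ (hE.1 i hi).1 _ (hE.1 i hi).2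

theorem AbsolutelyContinuousOnInterval.of_lipschitzWith_comp {M M' : Type*} [PseudoMetricSpace M]
    [PseudoMetricSpace M'] {X : ℝ → M} {a b : ℝ} {K : ℝ≥0} {F : M → M'}
    (hF : LipschitzWith K F) (hX : AbsolutelyContinuousOnInterval X a b) :
    AbsolutelyContinuousOnInterval (fun t => F (X t)) a b :=
  hX.of_dist_le (C := K) fun _ _ _ _ => hF.dist_le_mul _ _

/-- Absolutely continuous curves in a metric space are continuous. -/
theorem AbsolutelyContinuousOnInterval.continuousOn_of_pseudoMetric {M : Type*}
    [PseudoMetricSpace M] {X : ℝ → M} {a b : ℝ} (hX : AbsolutelyContinuousOnInterval X a b) :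
    ContinuousOn X (uIcc a b) := by
  intro t₀ ht₀
  have h := (hX.of_lipschitzWith_comp (LipschitzWith.dist_left (X t₀))).continuousOn t₀ ht₀
  rw [ContinuousWithinAt, tendsto_iff_dist_tendsto_zero]
  simpa [ContinuousWithinAt] using h

theorem AbsolutelyContinuousOnInterval.mono_Icc {M : Type*} [PseudoMetricSpace M] {X : ℝ → M}
    {a b c d : ℝ} (hX : AbsolutelyContinuousOnInterval X a b) (hac : a ≤ c) (hcd : c ≤ d)
    (hdb : d ≤ b) : AbsolutelyContinuousOnInterval X c d := by
  refine hX.mono ?_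
  rw [uIcc_of_le hcd, uIcc_of_le (hac.trans (hcd.trans hdb))]
  exact Icc_subset_Icc hac hdb

theorem AbsolutelyContinuousOnInterval.ae_hasDerivAt_of_Ioo {h : ℝ → ℝ} {a b : ℝ}
    (hh : AbsolutelyContinuousOnInterval h a b) :
    ∀ᵐ t : ℝ, t ∈ Ioo a b → HasDerivAt h (deriv h t) t := by
  filter_upwards [hh.ae_differentiableAt] with t ht hm
  exact (ht (Icc_subset_uIcc (Ioo_subset_Icc_self hm))).hasDerivAt

theorem AbsolutelyContinuousOnInterval.le_of_deriv_nonneg {h : ℝ → ℝ} {a b : ℝ} (hab : a ≤ b)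
    (hh : AbsolutelyContinuousOnInterval h a b)
    (hd : ∀ᵐ t : ℝ, t ∈ Ioo a b → ∀ d, HasDerivAt h d t → 0 ≤ d) : h a ≤ h b := by
  rw [← sub_nonneg, ← hh.integral_deriv_eq_sub, intervalIntegral.integral_of_le hab,
    integral_Ioc_eq_integral_Ioo]
  refine setIntegral_nonneg_ae measurableSet_Ioo ?_
  filter_upwards [hd, hh.ae_hasDerivAt_of_Ioo] with t ht ht' hm
  exact ht hm _ (ht' hm)

/-- Grönwall's inequality in differential form for absolutely continuous functions. -/
theorem AbsolutelyContinuousOnInterval.nonpos_of_deriv_le {φ : ℝ → ℝ} {a b K : ℝ}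
    (hφ : AbsolutelyContinuousOnInterval φ a b) (ha : φ a ≤ 0)
    (hd : ∀ᵐ t : ℝ, t ∈ Ioo a b → ∀ d, HasDerivAt φ d t → d ≤ K * φ t) :
    ∀ t ∈ Icc a b, φ t ≤ 0 := by
  intro t ht
  have hE : AbsolutelyContinuousOnInterval (fun s : ℝ => -Real.exp (-K * s)) a t := by
    refine ContDiffOn.absolutelyContinuousOnInterval (ContDiff.contDiffOn ?_)
    fun_prop
  have hψ := hE.fun_mul (hφ.mono_Icc le_rfl ht.1 ht.2)
  have h1 := hψ.le_of_deriv_nonneg ht.1 (by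
    filter_upwards [hd, hφ.ae_hasDerivAt_of_Ioo] with s hs hs' hm d hdd
    have hm' : s ∈ Ioo a b := ⟨hm.1, hm.2.trans_le ht.2⟩
    have hexp : HasDerivAt (fun s : ℝ => -Real.exp (-K * s)) (-(Real.exp (-K * s) * (-K))) s := by
      have := ((hasDerivAt_id s).const_mul (-K)).exp.fun_neg
      simpa using this
    have := hdd.unique (hexp.mul (hs' hm'))
    have h2 := hs hm' _ (hs' hm')
    have h3 : d = Real.exp (-K * s) * (K * φ s - deriv φ s) := by rw [this]; ring
    rw [h3]
    exact mul_nonneg (Real.exp_pos _).le (by linarith))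
  have e1 := Real.exp_pos (-K * a)
  have e2 := Real.exp_pos (-K * t)
  by_contra hlt
  push Not at hlt
  nlinarith [mul_pos e2 hlt]

/-- A function that does not decrease while it is negative stays nonnegative: its negative part
`min s 0` has nonnegative derivative almost everywhere. -/
theorem AbsolutelyContinuousOnInterval.nonneg_of_increasing_below {s : ℝ → ℝ} {a b : ℝ}
    (hs : AbsolutelyContinuousOnInterval s a b) (ha : 0 ≤ s a)
    (hd : ∀ᵐ t : ℝ, t ∈ Ioo a b → s t < 0 → ∃ d, 0 ≤ d ∧ HasDerivAt s d t) :
    ∀ t ∈ Icc a b, 0 ≤ s t := by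
  intro t ht
  have hL : LipschitzWith 1 (fun x : ℝ => min x 0) := LipschitzWith.id.min_const 0
  have hm := (hs.mono_Icc le_rfl ht.1 ht.2).of_lipschitzWith_comp hL
  have := hm.le_of_deriv_nonneg ht.1 (by
    filter_upwards [hd, hs.ae_hasDerivAt_of_Ioo] with τ h1 h2 hτ d hdd
    have hτ' : τ ∈ Ioo a b := ⟨hτ.1, hτ.2.trans_le ht.2⟩
    rcases lt_or_ge (s τ) 0 with hneg | hpos
    · obtain ⟨d', hd', h3⟩ := h1 hτ' hneg
      have : (fun x => min (s x) 0) =ᶠ[𝓝 τ] s := by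
        filter_upwards [h3.continuousAt.eventually_lt_const hneg] with x hx
        exact min_eq_left hx.le
      rw [hdd.unique (h3.congr_of_eventuallyEq this)]
      exact hd'
    · have hmax : IsLocalMax (fun x => min (s x) 0) τ := by
        refine Eventually.of_forall fun x => ?_
        simp only [min_eq_right hpos]
        exact min_le_right _ _
      rw [hmax.hasDerivAt_eq_zero hdd])
  simp only [min_eq_right ha] at this
  exact (le_min_iff.1 this).1

theorem abs_deriv_norm_le {E : Type*} [NormedAddCommGroup E] [NormedSpace ℝ E] {z : ℝ → E}
    {t d : ℝ} {w : E} (hz : HasDerivAt z w t) (hd : HasDerivAt (fun s => ‖z s‖) d t) :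
    |d| ≤ ‖w‖ := by
  have h1 := hd.tendsto_slope.norm
  have h2 := hz.tendsto_slope.norm
  refine le_of_tendsto_of_tendsto h1 h2 (Eventually.of_forall fun s => ?_)
  simp only [slope_def_module, norm_smul]
  exact mul_le_mul_of_nonneg_left (abs_norm_sub_norm_le _ _) (norm_nonneg _)

/-! ### Uniqueness for absolutely continuous solutions -/

/-- Carathéodory uniqueness for a field that is Lipschitz in the state. -/
theorem eqOn_of_lipschitz_field {E : Type*} [NormedAddCommGroup E] [NormedSpace ℝ E]
    {x y : ℝ → E} {a b : ℝ} {P : ℝ → E → E} {B : Set E} {K : ℝ≥0}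
    (hP : ∀ t ∈ Ioo a b, LipschitzOnWith K (P t) B)
    (hx : AbsolutelyContinuousOnInterval x a b) (hy : AbsolutelyContinuousOnInterval y a b)
    (hxB : ∀ t ∈ Icc a b, x t ∈ B) (hyB : ∀ t ∈ Icc a b, y t ∈ B) (hxy : x a = y a)
    (hx' : ∀ᵐ t : ℝ, t ∈ Ioo a b → HasDerivAt x (P t (x t)) t)
    (hy' : ∀ᵐ t : ℝ, t ∈ Ioo a b → HasDerivAt y (P t (y t)) t) :
    EqOn x y (Icc a b) := by
  have hφ := (hx.fun_sub hy).of_lipschitzWith_comp lipschitzWith_one_norm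
  have := hφ.nonpos_of_deriv_le (K := K) (by simp [hxy]) (by
    filter_upwards [hx', hy'] with t h1 h2 ht d hd
    have hm := Ioo_subset_Icc_self ht
    refine (le_abs_self d).trans ((abs_deriv_norm_le ((h1 ht).fun_sub (h2 ht)) hd).trans ?_)
    exact (hP t ht).norm_sub_le (hxB t hm) (hyB t hm))
  intro t ht
  exact sub_eq_zero.1 (norm_le_zero_iff.1 (this t ht))

section Transverse

variable {E : Type*} [NormedAddCommGroup E] [InnerProductSpace ℝ E]

/-- If a convex combination `(1 - l) p + l q` is tangent to the hyperplane and `q` points to the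
positive side, then `p` does not. In particular the normal parts of `p` and `q` differ. -/
theorem inner_nonpos_of_tangent {N p q : E} {c l : ℝ} (hc : 0 < c) (hq : c ≤ inner ℝ N q)
    (h0 : 0 ≤ l) (h1 : l ≤ 1) (hw : inner ℝ N (p + l • (q - p)) = 0) : inner ℝ N p ≤ 0 := by
  rw [inner_add_right, inner_smul_right, inner_sub_right] at hw
  by_contra! h
  nlinarith [mul_nonneg (sub_nonneg.2 h1) h.le, mul_nonneg h0 (hc.trans_le hq).le]

/-- Two sliding velocities at nearby points are close. -/
theorem norm_sliding_sub_sliding_le {N p q p' q' : E} {c l l' M δ : ℝ} (hN : ‖N‖ = 1) (hc : 0 < c)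
    (hq : c ≤ inner ℝ N q) (hM : ‖q' - p'‖ ≤ M) (hp : ‖p - p'‖ ≤ δ) (hqq : ‖q - q'‖ ≤ δ)
    (h0 : 0 ≤ l) (h1 : l ≤ 1) (h0' : 0 ≤ l') (h1' : l' ≤ 1)
    (hw : inner ℝ N (p + l • (q - p)) = 0) (hw' : inner ℝ N (p' + l' • (q' - p')) = 0) :
    ‖(p + l • (q - p)) - (p' + l' • (q' - p'))‖ ≤ (3 + 3 * M / c) * δ := by
  have hp0 := inner_nonpos_of_tangent hc hq h0 h1 hw
  have ip : |inner ℝ N (p - p')| ≤ δ :=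
    (abs_real_inner_le_norm _ _).trans (by rw [hN, one_mul]; exact hp)
  have iq : |inner ℝ N (q - q')| ≤ δ :=
    (abs_real_inner_le_norm _ _).trans (by rw [hN, one_mul]; exact hqq)
  have hδ : 0 ≤ δ := (norm_nonneg _).trans hp
  have hγ : ‖(q - p) - (q' - p')‖ ≤ 2 * δ := by
    have : (q - p) - (q' - p') = (q - q') - (p - p') := by abel
    rw [this]
    exact (norm_sub_le _ _).trans (by linarith)
  -- `(l - l') ⟪N, q - p⟫` is the difference of the data, and `⟪N, q - p⟫ ≥ c`
  have hll : |l - l'| ≤ 3 * δ / c := by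
    rw [le_div_iff₀ hc]
    rw [inner_add_right, inner_smul_right, inner_sub_right] at hw hw'
    rw [inner_sub_right] at ip iq
    have e : (l - l') * (inner ℝ N q - inner ℝ N p) =
        -(inner ℝ N p - inner ℝ N p') * (1 - l') - l' * (inner ℝ N q - inner ℝ N q') := by
      linear_combination hw - hw'
    have hb : c ≤ inner ℝ N q - inner ℝ N p := by linarith
    calc |l - l'| * c ≤ |l - l'| * |inner ℝ N q - inner ℝ N p| :=
          mul_le_mul_of_nonneg_left (hb.trans (le_abs_self _)) (abs_nonneg _)
      _ = |-(inner ℝ N p - inner ℝ N p') * (1 - l') - l' * (inner ℝ N q - inner ℝ N q')| := by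
          rw [← abs_mul, e]
      _ ≤ δ * 1 + 1 * δ := by
          refine (abs_sub _ _).trans (add_le_add ?_ ?_)
          · rw [abs_mul, abs_neg]
            exact mul_le_mul ip (by rw [abs_le]; constructor <;> linarith) (abs_nonneg _) hδ
          · rw [abs_mul]
            exact mul_le_mul (by rw [abs_le]; constructor <;> linarith) iq (abs_nonneg _)
              zero_le_one
      _ ≤ 3 * δ := by linarith
  have e : (p + l • (q - p)) - (p' + l' • (q' - p')) =
      (p - p') + l • ((q - p) - (q' - p')) + (l - l') • (q' - p') := by
    module
  rw [e]
  have n1 : ‖l • ((q - p) - (q' - p'))‖ ≤ 2 * δ := by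
    rw [norm_smul, Real.norm_of_nonneg h0]
    nlinarith [norm_nonneg ((q - p) - (q' - p'))]
  have n2 : ‖(l - l') • (q' - p')‖ ≤ 3 * δ / c * M := by
    rw [norm_smul]
    exact mul_le_mul hll hM (norm_nonneg _) (by positivity)
  calc _ ≤ ‖p - p'‖ + ‖l • ((q - p) - (q' - p'))‖ + ‖(l - l') • (q' - p')‖ := norm_add₃_le
    _ ≤ δ + 2 * δ + 3 * δ / c * M := by gcongr
    _ = (3 + 3 * M / c) * δ := by ring

/-- A sliding velocity at one point against a one-sided velocity at a nearby point: what is not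
controlled by the distance is paid for by the decrease of the normal distance. -/
theorem norm_sliding_sub_add_inner_le {N p q p' : E} {c l M δ : ℝ} (hN : ‖N‖ = 1) (hc : 0 < c)
    (hq : c ≤ inner ℝ N q) (hM : ‖q - p‖ ≤ M) (hp : ‖p - p'‖ ≤ δ)
    (h0 : 0 ≤ l) (h1 : l ≤ 1) (hw : inner ℝ N (p + l • (q - p)) = 0) :
    ‖(p + l • (q - p)) - p'‖ + M / c * inner ℝ N p' ≤ (1 + M / c) * δ := by
  have hp0 := inner_nonpos_of_tangent hc hq h0 h1 hw
  have ip : |inner ℝ N (p - p')| ≤ δ :=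
    (abs_real_inner_le_norm _ _).trans (by rw [hN, one_mul]; exact hp)
  rw [inner_sub_right, abs_le] at ip
  rw [inner_add_right, inner_smul_right, inner_sub_right] at hw
  have hM0 : 0 ≤ M := (norm_nonneg _).trans hM
  have hl : l ≤ -inner ℝ N p / c := by
    rw [le_div_iff₀ hc]
    nlinarith
  have e : (p + l • (q - p)) - p' = (p - p') + l • (q - p) := by abel
  have n1 : ‖l • (q - p)‖ ≤ -inner ℝ N p / c * M := by
    rw [norm_smul, Real.norm_of_nonneg h0]
    exact mul_le_mul hl hM (norm_nonneg _) (h0.trans hl)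
  have hMc : 0 ≤ M / c := by positivity
  have n2 : M / c * (inner ℝ N p' - inner ℝ N p) ≤ M / c * δ :=
    mul_le_mul_of_nonneg_left (by linarith) hMc
  rw [e]
  calc _ ≤ δ + -inner ℝ N p / c * M + M / c * inner ℝ N p' := by
        gcongr
        exact (norm_add_le _ _).trans (add_le_add hp n1)
    _ = δ + M / c * (inner ℝ N p' - inner ℝ N p) := by ring
    _ ≤ _ := by linarith

/-- `w` is an admissible velocity at `x` for the discontinuous field equal to `p` on the positive
side and to `q` on the negative side of the hyperplane `⟪N, ·⟫ = c₀`, where `p` and `q` are the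
values of the two fields at `x`. -/
def IsSwitchingVelocity (N : E) (c₀ : ℝ) (p q x w : E) : Prop :=
  (inner ℝ N x - c₀ < 0 → w = q) ∧ (0 < inner ℝ N x - c₀ → w = p) ∧
    (inner ℝ N x - c₀ = 0 → ∃ l : ℝ, 0 ≤ l ∧ l ≤ 1 ∧ w = p + l • (q - p))

/-- Uniqueness across a hyperplane towards which the field on the negative side points. A solution
that starts on the hyperplane never enters the negative side, so whenever it is on the hyperplane
its velocity is tangent. The weighted distance `‖x - y‖ + C |⟪N, x - y⟫|` then grows at most
exponentially: the reflection terms, which are not controlled by `‖x - y‖`, are dominated by the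
decrease of the normal distance that they produce. -/
theorem eqOn_of_transverse_field {x y : ℝ → E} {a b c c₀ M : ℝ} {P Q : ℝ → E → E} {N : E}
    {B : Set E} {K : ℝ≥0} (hN : ‖N‖ = 1) (hc : 0 < c)
    (hP : ∀ t ∈ Ioo a b, LipschitzOnWith K (P t) B)
    (hQ : ∀ t ∈ Ioo a b, LipschitzOnWith K (Q t) B)
    (hM : ∀ t ∈ Ioo a b, ∀ z ∈ B, ‖Q t z - P t z‖ ≤ M)
    (hNQ : ∀ t ∈ Ioo a b, ∀ z ∈ B, c ≤ inner ℝ N (Q t z))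
    (hx : AbsolutelyContinuousOnInterval x a b) (hy : AbsolutelyContinuousOnInterval y a b)
    (hxB : ∀ t ∈ Icc a b, x t ∈ B) (hyB : ∀ t ∈ Icc a b, y t ∈ B) (hxy : x a = y a)
    (ha : inner ℝ N (x a) - c₀ = 0)
    (hx' : ∀ᵐ t : ℝ, t ∈ Ioo a b →
      ∃ w, IsSwitchingVelocity N c₀ (P t (x t)) (Q t (x t)) (x t) w ∧ HasDerivAt x w t)
    (hy' : ∀ᵐ t : ℝ, t ∈ Ioo a b →
      ∃ w, IsSwitchingVelocity N c₀ (P t (y t)) (Q t (y t)) (y t) w ∧ HasDerivAt y w t) :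
    EqOn x y (Icc a b) := by
  have hLin : LipschitzWith 1 (fun z : E => inner ℝ N z - c₀) := by
    refine LipschitzWith.of_dist_le_mul fun z z' => ?_
    rw [Real.dist_eq, dist_eq_norm, sub_sub_sub_cancel_right, ← inner_sub_right]
    simpa [hN] using abs_real_inner_le_norm N (z - z')
  have hder : ∀ {z : ℝ → E} {w : E} {t : ℝ}, HasDerivAt z w t →
      HasDerivAt (fun t => inner ℝ N (z t) - c₀) (inner ℝ N w) t := by
    intro z w t h
    simpa using ((hasDerivAt_const t N).inner ℝ h).sub_const c₀
  have stay : ∀ z : ℝ → E, AbsolutelyContinuousOnInterval z a b → (∀ t ∈ Icc a b, z t ∈ B) →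
      inner ℝ N (z a) - c₀ = 0 → (∀ᵐ t : ℝ, t ∈ Ioo a b → ∃ w,
        IsSwitchingVelocity N c₀ (P t (z t)) (Q t (z t)) (z t) w ∧ HasDerivAt z w t) →
      ∀ t ∈ Icc a b, 0 ≤ inner ℝ N (z t) - c₀ := by
    intro z hz hzB hza hz'
    refine (hz.of_lipschitzWith_comp hLin).nonneg_of_increasing_below hza.ge ?_
    filter_upwards [hz'] with t h ht hneg
    obtain ⟨w, hw, hd⟩ := h ht
    refine ⟨_, ?_, hder hd⟩
    rw [hw.1 hneg]
    exact hc.le.trans (hNQ t ht _ (hzB t (Ioo_subset_Icc_self ht)))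
  have hsx := stay x hx hxB ha hx'
  have hsy := stay y hy hyB (hxy ▸ ha) hy'
  -- on the hyperplane the velocity is tangent, since the normal coordinate has a minimum
  have tang : ∀ z : ℝ → E, (∀ t ∈ Icc a b, 0 ≤ inner ℝ N (z t) - c₀) → ∀ t ∈ Ioo a b, ∀ w,
      inner ℝ N (z t) - c₀ = 0 → HasDerivAt z w t → inner ℝ N w = 0 := by
    intro z hz t ht w h0 hd
    have hmin : IsLocalMin (fun t => inner ℝ N (z t) - c₀) t := by
      filter_upwards [Icc_mem_nhds ht.1 ht.2] with s hs
      rw [h0]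
      exact hz s hs
    exact hmin.hasDerivAt_eq_zero (hder hd)
  -- `M / c` bounds the sliding term by the normal speed it produces
  set C : ℝ := M / c with hC
  have hz := hx.fun_sub hy
  have h1 := hz.of_lipschitzWith_comp lipschitzWith_one_norm
  have h2 := ((hx.of_lipschitzWith_comp hLin).fun_sub
    (hy.of_lipschitzWith_comp hLin)).of_lipschitzWith_comp lipschitzWith_one_norm
  have hφ := h1.fun_add (h2.const_mul C)
  rcases le_or_gt b a with hba | hab
  · intro t ht
    have : t = a := le_antisymm (ht.2.trans hba) ht.1
    rw [this, hxy]
  have hM0 : 0 ≤ M := by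
    have hm : (a + b) / 2 ∈ Ioo a b := ⟨by linarith, by linarith⟩
    exact (norm_nonneg _).trans (hM _ hm _ (hxB _ (Ioo_subset_Icc_self hm)))
  have hC0 : 0 ≤ C := by positivity
  have key := hφ.nonpos_of_deriv_le (K := (3 + 3 * C) * K) (by simp [hxy]) (by
    filter_upwards [hx', hy', h1.ae_hasDerivAt_of_Ioo, h2.ae_hasDerivAt_of_Ioo] with
      t hxt hyt h1t h2t ht d hd
    have hm := Ioo_subset_Icc_self ht
    obtain ⟨w, hw, hdx⟩ := hxt ht
    obtain ⟨w', hw', hdy⟩ := hyt ht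
    have hd1 := h1t ht
    have hd2 := h2t ht
    set d1 := deriv (fun t => ‖x t - y t‖) t
    set d2 := deriv (fun t => ‖(inner ℝ N (x t) - c₀) - (inner ℝ N (y t) - c₀)‖) t
    rw [hd.unique (hd1.add (hd2.const_mul C))]
    have b1 : d1 ≤ ‖w - w'‖ := (le_abs_self _).trans (abs_deriv_norm_le (hdx.fun_sub hdy) hd1)
    have b2 : d2 ≤ ‖inner ℝ N w - inner ℝ N w'‖ :=
      (le_abs_self _).trans (abs_deriv_norm_le ((hder hdx).fun_sub (hder hdy)) hd2)
    have hxb := hxB t hm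
    have hyb := hyB t hm
    have lP := (hP t ht).norm_sub_le hxb hyb
    have lQ := (hQ t ht).norm_sub_le hxb hyb
    set δ := (K : ℝ) * ‖x t - y t‖
    have hδ : 0 ≤ δ := by positivity
    suffices d1 + C * d2 ≤ (3 + 3 * C) * δ by
      have hnn : 0 ≤ (3 + 3 * C) * K * (C * ‖(inner ℝ N (x t) - c₀) - (inner ℝ N (y t) - c₀)‖) := by
        positivity
      simp only [δ] at this
      nlinarith
    rcases (hsx t hm).eq_or_lt' with sx | sx <;> rcases (hsy t hm).eq_or_lt' with sy | sy
    · obtain ⟨l, l0, l1, rfl⟩ := hw.2.2 sx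
      obtain ⟨l', l0', l1', rfl⟩ := hw'.2.2 sy
      have tx := tang x hsx t ht _ sx hdx
      have ty := tang y hsy t ht _ sy hdy
      have := norm_sliding_sub_sliding_le hN hc (hNQ t ht _ hxb) (hM t ht _ hyb) lP lQ l0 l1 l0' l1'
        tx ty
      rw [tx, ty, sub_zero, norm_zero] at b2
      have : (3 + 3 * M / c) * δ = (3 + 3 * C) * δ := by rw [hC]; ring
      nlinarith
    · obtain ⟨l, l0, l1, rfl⟩ := hw.2.2 sx
      obtain rfl := hw'.2.1 sy
      have tx := tang x hsx t ht _ sx hdx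
      have key := norm_sliding_sub_add_inner_le hN hc (hNQ t ht _ hxb) (hM t ht _ hxb) lP l0 l1 tx
      have e2 : d2 = inner ℝ N (P t (y t)) := by
        have h3 := (hder hdy).fun_sub (hder hdx)
        rw [tx, sub_zero] at h3
        refine hd2.unique (h3.congr_of_eventuallyEq ?_)
        have hpos : 0 < (inner ℝ N (y t) - c₀) - (inner ℝ N (x t) - c₀) := by
          rw [sx]; simpa using sy
        filter_upwards [h3.continuousAt.eventually_const_lt hpos] with s hs
        rw [norm_sub_rev, Real.norm_of_nonneg hs.le]
      rw [e2]
      nlinarith [mul_nonneg hC0 hδ]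
    · obtain rfl := hw.2.1 sx
      obtain ⟨l, l0, l1, rfl⟩ := hw'.2.2 sy
      have ty := tang y hsy t ht _ sy hdy
      rw [norm_sub_rev] at b1 lP
      have key := norm_sliding_sub_add_inner_le hN hc (hNQ t ht _ hyb) (hM t ht _ hyb) lP l0 l1 ty
      have e2 : d2 = inner ℝ N (P t (x t)) := by
        have h3 := (hder hdx).fun_sub (hder hdy)
        rw [ty, sub_zero] at h3
        refine hd2.unique (h3.congr_of_eventuallyEq ?_)
        have hpos : 0 < (inner ℝ N (x t) - c₀) - (inner ℝ N (y t) - c₀) := by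
          rw [sy]; simpa using sx
        filter_upwards [h3.continuousAt.eventually_const_lt hpos] with s hs
        rw [Real.norm_of_nonneg hs.le]
      rw [e2]
      nlinarith [mul_nonneg hC0 hδ]
    · obtain rfl := hw.2.1 sx
      obtain rfl := hw'.2.1 sy
      have : ‖inner ℝ N (P t (x t)) - inner ℝ N (P t (y t))‖ ≤ δ := by
        rw [← inner_sub_right]
        exact (abs_real_inner_le_norm _ _).trans (by rw [hN, one_mul]; exact lP)
      nlinarith [mul_nonneg hC0 hδ])
  intro t ht
  have h3 := key t ht
  have h4 : 0 ≤ C * ‖(inner ℝ N (x t) - c₀) - (inner ℝ N (y t) - c₀)‖ := by positivity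
  exact sub_eq_zero.1 (norm_le_zero_iff.1 (by linarith))

end Transverse

/-! ### The Filippov regularization near a hyperplane -/

/-- The Filippov set lies in a closed convex set that the field values approach off a null set. -/
theorem filippovReg_subset {n m : ℕ} {V : Set (Eu n)} {f : Eu n → Eu m → Eu n} {x : Eu n}
    {v : Eu m} {C : Set (Eu n)} (hC : IsClosed C) (hconv : Convex ℝ C)
    (h : ∀ ε > 0, ∃ S : Set (Eu n), volume S = 0 ∧
      ∀ᶠ y in 𝓝 x, y ∉ S → ∃ z ∈ C, dist (f y v) z ≤ ε) :
    filippovReg V f x v ⊆ C := by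
  intro w hw
  rw [← hC.closure_eq, Metric.closure_eq_iInter_cthickening]
  simp only [mem_iInter]
  intro ε hε
  obtain ⟨S, hS, hev⟩ := h ε hε
  obtain ⟨δ, hδ, hball⟩ := Metric.eventually_nhds_iff_ball.1 hev
  simp only [filippovReg, mem_iInter] at hw
  refine closure_minimal (convexHull_min ?_ (hconv.cthickening ε)) Metric.isClosed_cthickening
    (hw δ hδ S hS)
  rintro _ ⟨y, ⟨⟨hyb, -⟩, hyS⟩, rfl⟩
  obtain ⟨z, hz, hd⟩ := hball y hyb hyS
  exact Metric.mem_cthickening_of_dist_le _ z _ _ hz hd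

theorem filippovReg_subset_singleton {n m : ℕ} {V : Set (Eu n)} {f P : Eu n → Eu m → Eu n}
    {x : Eu n} {v : Eu m} (hP : ContinuousAt (fun y => P y v) x)
    (hf : ∀ᶠ y in 𝓝 x, f y v = P y v) : filippovReg V f x v ⊆ {P x v} := by
  refine filippovReg_subset isClosed_singleton (convex_singleton _) fun ε hε => ⟨∅, by simp, ?_⟩
  filter_upwards [hf, Metric.tendsto_nhds.1 hP ε hε] with y h1 h2 _
  exact ⟨_, rfl, by rw [h1]; exact h2.le⟩

theorem volume_hyperplane {n : ℕ} {N : Eu n} (hN : ‖N‖ = 1) (c₀ : ℝ) :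
    volume {y : Eu n | inner ℝ N y - c₀ = 0} = 0 := by
  let L : Eu n →ₗ[ℝ] ℝ := (innerSL ℝ N).toLinearMap
  let A : AffineSubspace ℝ (Eu n) := (LinearMap.ker L).toAffineSubspace.map
    (AffineEquiv.constVAdd ℝ (Eu n) (c₀ • N)).toAffineMap
  have hA : ∀ y, y ∈ A ↔ inner ℝ N y - c₀ = 0 := by
    have hNN : inner ℝ N N = (1 : ℝ) := by rw [real_inner_self_eq_norm_sq, hN]; norm_num
    intro y
    rw [AffineSubspace.mem_map]
    constructor
    · rintro ⟨z, hz, rfl⟩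
      have hz' : inner ℝ N z = (0 : ℝ) := hz
      simp [inner_add_right, inner_smul_right, hz', hN]
    · intro hy
      refine ⟨y - c₀ • N, ?_, by simp⟩
      change inner ℝ N (y - c₀ • N) = (0 : ℝ)
      rw [inner_sub_right, inner_smul_right, hNN]
      linarith
  have hne : A ≠ ⊤ := by
    intro h
    have hNN : inner ℝ N N = (1 : ℝ) := by rw [real_inner_self_eq_norm_sq, hN]; norm_num
    have h1 := (hA ((c₀ + 1) • N)).1 (by rw [h]; trivial)
    rw [inner_smul_right, hNN] at h1
    linarith
  have := Measure.addHaar_affineSubspace volume A hne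
  convert this using 2
  ext y
  exact (hA y).symm

/-- On the hyperplane, which is a null set, the values of `f` are disregarded. -/
theorem isSwitchingVelocity_of_mem_filippovReg {n m : ℕ} {V : Set (Eu n)}
    {f P Q : Eu n → Eu m → Eu n} {x : Eu n} {v : Eu m} {N : Eu n} {c₀ : ℝ} (hN : ‖N‖ = 1)
    (hP : ContinuousAt (fun y => P y v) x) (hQ : ContinuousAt (fun y => Q y v) x)
    (hfP : ∀ᶠ y in 𝓝 x, 0 < inner ℝ N y - c₀ → f y v = P y v)
    (hfQ : ∀ᶠ y in 𝓝 x, inner ℝ N y - c₀ < 0 → f y v = Q y v) {w : Eu n}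
    (hw : w ∈ filippovReg V f x v) : IsSwitchingVelocity N c₀ (P x v) (Q x v) x w := by
  have hs : Continuous fun y : Eu n => inner ℝ N y - c₀ := by fun_prop
  refine ⟨fun hx => ?_, fun hx => ?_, fun hx => ?_⟩
  · refine filippovReg_subset_singleton hQ ?_ hw
    filter_upwards [hfQ, hs.continuousAt.eventually_lt_const hx] with y h1 h2 using h1 h2
  · refine filippovReg_subset_singleton hP ?_ hw
    filter_upwards [hfP, hs.continuousAt.eventually_const_lt hx] with y h1 h2 using h1 h2
  · have hseg : filippovReg V f x v ⊆ segment ℝ (P x v) (Q x v) := by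
      have hcl : IsClosed (segment ℝ (P x v) (Q x v)) := by
        rw [← convexHull_pair]
        exact (Set.toFinite _).isClosed_convexHull ℝ
      refine filippovReg_subset hcl (convex_segment _ _) fun ε hε =>
        ⟨_, volume_hyperplane hN c₀, ?_⟩
      filter_upwards [hfP, hfQ, Metric.tendsto_nhds.1 hP ε hε, Metric.tendsto_nhds.1 hQ ε hε] with
        y h1 h2 h3 h4 hy
      rcases lt_or_gt_of_ne (hy : inner ℝ N y - c₀ ≠ 0) with h | h
      · exact ⟨_, right_mem_segment ℝ _ _, by rw [h2 h]; exact h4.le⟩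
      · exact ⟨_, left_mem_segment ℝ _ _, by rw [h1 h]; exact h3.le⟩
    obtain ⟨l, hl, rfl⟩ := (segment_eq_image' ℝ (P x v) (Q x v) ▸ hseg) hw
    exact ⟨l, hl.1, hl.2, rfl⟩

/-! ### Local right uniqueness in coordinates -/

/-- `x` is an absolutely continuous solution on `[t₀, t₁]` of the differential inclusion given by
the Filippov regularization of `f` along the input `u`. -/
def IsFilippovCurve {n m : ℕ} (V : Set (Eu n)) (f : Eu n → Eu m → Eu n) (u : ℝ → Eu m)
    (t₀ t₁ : ℝ) (x : ℝ → Eu n) : Prop :=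
  AbsolutelyContinuousOnInterval x t₀ t₁ ∧
    ∀ᵐ t : ℝ, t ∈ Ioo t₀ t₁ → ∃ w ∈ filippovReg V f (x t) (u t), HasDerivAt x w t

/-- Any two Filippov curves that start at `p` at time `t₀` agree for as long as they remain in a
fixed neighbourhood of `p` and in a fixed time interval. -/
def LocalRightUniqueness {n m : ℕ} (V : Set (Eu n)) (f : Eu n → Eu m → Eu n) (u : ℝ → Eu m)
    (t₀ : ℝ) (p : Eu n) : Prop :=
  ∃ N ∈ 𝓝 p, ∃ t₁ > t₀, ∀ t₂ ≤ t₁, ∀ x y : ℝ → Eu n,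
    IsFilippovCurve V f u t₀ t₂ x → IsFilippovCurve V f u t₀ t₂ y →
    (∀ t ∈ Icc t₀ t₂, x t ∈ N) → (∀ t ∈ Icc t₀ t₂, y t ∈ N) → x t₀ = p → y t₀ = p →
    EqOn x y (Icc t₀ t₂)

/-- The field `P` is Lipschitz in the state near `p`, uniformly in the inputs of `U` near `v₀`, and
jointly continuous at `(p, v₀)`. -/
structure IsRegularFieldAt {n m : ℕ} (U : Set (Eu m)) (P : Eu n → Eu m → Eu n) (p : Eu n)
    (v₀ : Eu m) : Prop where
  lipschitz : ∃ K : ℝ≥0, ∃ N ∈ 𝓝 p, ∀ᶠ v in 𝓝[U] v₀, LipschitzOnWith K (fun x => P x v) N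
  continuous : Tendsto (fun q : Eu n × Eu m => P q.1 q.2) (𝓝 p ×ˢ 𝓝[U] v₀) (𝓝 (P p v₀))

theorem exists_Ioo_of_eventually_nhdsGT {p : ℝ → Prop} {t₀ : ℝ} (h : ∀ᶠ t in 𝓝[>] t₀, p t) :
    ∃ t₁ > t₀, ∀ t ∈ Ioo t₀ t₁, p t := by
  obtain ⟨t₁, h1, h2⟩ := mem_nhdsGT_iff_exists_Ioo_subset.1 h
  exact ⟨t₁, h1, h2⟩

theorem localRightUniqueness_of_regular {n m : ℕ} {V : Set (Eu n)} {f P : Eu n → Eu m → Eu n}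
    {u : ℝ → Eu m} {U : Set (Eu m)} {t₀ : ℝ} {p : Eu n} {v₀ : Eu m}
    (hu : Tendsto u (𝓝[>] t₀) (𝓝[U] v₀)) (hP : IsRegularFieldAt U P p v₀)
    (hf : ∀ᶠ y in 𝓝 p, ∀ v, f y v = P y v) : LocalRightUniqueness V f u t₀ p := by
  obtain ⟨K, N, hN, hK⟩ := hP.lipschitz
  obtain ⟨t₁, ht₁, hKt⟩ := exists_Ioo_of_eventually_nhdsGT (hu.eventually hK)
  obtain ⟨B, hBN, hBo, hpB⟩ := mem_nhds_iff.1 (inter_mem hN hf)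
  refine ⟨B, hBo.mem_nhds hpB, t₁, ht₁, fun t₂ ht₂ x y hx hy hxB hyB hx0 hy0 => ?_⟩
  have hlip : ∀ t ∈ Ioo t₀ t₂, LipschitzOnWith K (fun x => P x (u t)) B := fun t ht =>
    (hKt t ⟨ht.1, ht.2.trans_le ht₂⟩).mono fun z hz => (hBN hz).1
  have hder : ∀ z, IsFilippovCurve V f u t₀ t₂ z → (∀ t ∈ Icc t₀ t₂, z t ∈ B) →
      ∀ᵐ t : ℝ, t ∈ Ioo t₀ t₂ → HasDerivAt z (P (z t) (u t)) t := by
    intro z hz hzB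
    filter_upwards [hz.2] with t h ht
    obtain ⟨w, hw, hd⟩ := h ht
    have hB := hBo.mem_nhds (hzB t (Ioo_subset_Icc_self ht))
    rwa [filippovReg_subset_singleton ((hlip t ht).continuousOn.continuousAt hB)
      (mem_of_superset hB fun z hz => (hBN hz).2 _) hw] at hd
  exact eqOn_of_lipschitz_field (P := fun t x => P x (u t)) hlip hx.1 hy.1 hxB hyB
    (hx0.trans hy0.symm) (hder x hx hxB) (hder y hy hyB)

theorem localRightUniqueness_of_inner_pos {n m : ℕ} {V : Set (Eu n)} {f P Q : Eu n → Eu m → Eu n}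
    {u : ℝ → Eu m} {U : Set (Eu m)} {t₀ : ℝ} {p N : Eu n} {v₀ : Eu m} {c₀ : ℝ}
    (hu : Tendsto u (𝓝[>] t₀) (𝓝[U] v₀)) (hP : IsRegularFieldAt U P p v₀)
    (hQ : IsRegularFieldAt U Q p v₀) (hN : ‖N‖ = 1) (hp : inner ℝ N p - c₀ = 0)
    (hfP : ∀ᶠ y in 𝓝 p, ∀ v, 0 < inner ℝ N y - c₀ → f y v = P y v)
    (hfQ : ∀ᶠ y in 𝓝 p, ∀ v, inner ℝ N y - c₀ < 0 → f y v = Q y v)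
    (hpos : 0 < inner ℝ N (Q p v₀)) : LocalRightUniqueness V f u t₀ p := by
  obtain ⟨K₁, N₁, hN₁, hK₁⟩ := hP.lipschitz
  obtain ⟨K₂, N₂, hN₂, hK₂⟩ := hQ.lipschitz
  obtain ⟨c, hc, hcQ⟩ := exists_between hpos
  have e1 : ∀ᶠ q in 𝓝 p ×ˢ 𝓝[U] v₀, c < inner ℝ N (Q q.1 q.2) :=
    ((continuous_const.inner continuous_id).continuousAt.tendsto.comp
      hQ.continuous).eventually_const_lt hcQ
  have e2 : ∀ᶠ q in 𝓝 p ×ˢ 𝓝[U] v₀, ‖Q q.1 q.2 - P q.1 q.2‖ < ‖Q p v₀ - P p v₀‖ + 1 :=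
    (hQ.continuous.sub hP.continuous).norm.eventually_lt_const (lt_add_one _)
  obtain ⟨pa, ha, pb, hb, hab⟩ := eventually_prod_iff.1 (e1.and e2)
  obtain ⟨t₁, ht₁, hKt⟩ := exists_Ioo_of_eventually_nhdsGT
    (hu.eventually (hK₁.and (hK₂.and hb)))
  obtain ⟨B, hB, hBo, hpB⟩ := mem_nhds_iff.1
    (inter_mem (inter_mem hN₁ hN₂) (inter_mem ha (inter_mem hfP hfQ)))
  refine ⟨B, hBo.mem_nhds hpB, t₁, ht₁, fun t₂ ht₂ x y hx hy hxB hyB hx0 hy0 => ?_⟩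
  have hK : ∀ t ∈ Ioo t₀ t₂, _ := fun t ht => hKt t ⟨ht.1, ht.2.trans_le ht₂⟩
  have hlipP : ∀ t ∈ Ioo t₀ t₂, LipschitzOnWith (max K₁ K₂) (fun x => P x (u t)) B := fun t ht =>
    ((hK t ht).1.weaken (le_max_left _ _)).mono fun z hz => (hB hz).1.1
  have hlipQ : ∀ t ∈ Ioo t₀ t₂, LipschitzOnWith (max K₁ K₂) (fun x => Q x (u t)) B := fun t ht =>
    ((hK t ht).2.1.weaken (le_max_right _ _)).mono fun z hz => (hB hz).1.2
  have hder : ∀ z, IsFilippovCurve V f u t₀ t₂ z → (∀ t ∈ Icc t₀ t₂, z t ∈ B) →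
      ∀ᵐ t : ℝ, t ∈ Ioo t₀ t₂ → ∃ w,
        IsSwitchingVelocity N c₀ (P (z t) (u t)) (Q (z t) (u t)) (z t) w ∧ HasDerivAt z w t := by
    intro z hz hzB
    filter_upwards [hz.2] with t h ht
    obtain ⟨w, hw, hd⟩ := h ht
    have hBz := hBo.mem_nhds (hzB t (Ioo_subset_Icc_self ht))
    exact ⟨w, isSwitchingVelocity_of_mem_filippovReg hN
      ((hlipP t ht).continuousOn.continuousAt hBz) ((hlipQ t ht).continuousOn.continuousAt hBz)
      (mem_of_superset hBz fun z hz => (hB hz).2.2.1 _)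
      (mem_of_superset hBz fun z hz => (hB hz).2.2.2 _) hw, hd⟩
  exact eqOn_of_transverse_field (P := fun t x => P x (u t)) (Q := fun t x => Q x (u t)) hN hc
    hlipP hlipQ (fun t ht z hz => (hab (hB hz).2.1 (hK t ht).2.2).2.le)
    (fun t ht z hz => (hab (hB hz).2.1 (hK t ht).2.2).1.le) hx.1 hy.1 hxB hyB
    (hx0.trans hy0.symm) (hx0 ▸ hp) (hder x hx hxB) (hder y hy hyB)

theorem localRightUniqueness_of_transverse {n m : ℕ} {V : Set (Eu n)}
    {f P Q : Eu n → Eu m → Eu n} {u : ℝ → Eu m} {U : Set (Eu m)} {t₀ : ℝ} {p N : Eu n}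
    {v₀ : Eu m} {c₀ : ℝ} (hu : Tendsto u (𝓝[>] t₀) (𝓝[U] v₀)) (hP : IsRegularFieldAt U P p v₀)
    (hQ : IsRegularFieldAt U Q p v₀) (hN : ‖N‖ = 1) (hp : inner ℝ N p - c₀ = 0)
    (hfP : ∀ᶠ y in 𝓝 p, ∀ v, 0 < inner ℝ N y - c₀ → f y v = P y v)
    (hfQ : ∀ᶠ y in 𝓝 p, ∀ v, inner ℝ N y - c₀ < 0 → f y v = Q y v)
    (h : 0 < inner ℝ N (Q p v₀) ∨ inner ℝ N (P p v₀) < 0) : LocalRightUniqueness V f u t₀ p := by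
  rcases h with h | h
  · exact localRightUniqueness_of_inner_pos hu hP hQ hN hp hfP hfQ h
  -- reversing the normal exchanges the two sides
  · have e : ∀ y : Eu n, inner ℝ (-N) y - -c₀ = -(inner ℝ N y - c₀) := fun y => by
      rw [inner_neg_left]; ring
    refine localRightUniqueness_of_inner_pos (N := -N) (c₀ := -c₀) hu hQ hP (by rwa [norm_neg])
      (by rw [e, hp, neg_zero]) ?_ ?_ (by rw [inner_neg_left]; linarith)
    · filter_upwards [hfQ] with y hy v hv
      exact hy v (by rw [e] at hv; linarith)
    · filter_upwards [hfP] with y hy v hv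
      exact hy v (by rw [e] at hv; linarith)

/-! ### Passage to a chart -/

/-- A curve that satisfies the inclusion in a chart lifts to a Filippov curve for as long as it
remains in the image of a domain of injectivity of the chart. -/
theorem exists_isFilippovCurve_lift {n m : ℕ} {M : Type*} [MetricSpace M] {V : Set (Eu n)}
    {φ : V → M} {f : Eu n → Eu m → Eu n} {u : ℝ → Eu m} {T t₀ s C : ℝ} {B : Set V} {Z : ℝ → M}
    (hV : IsOpen V) (hBo : IsOpen B)
    (hC : ∀ x ∈ B, ∀ y ∈ B, dist (x : Eu n) y ≤ C * dist (φ x) (φ y))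
    (h0 : 0 ≤ t₀) (hs : t₀ < s) (hsT : s ≤ T)
    (hZ : AbsolutelyContinuousOnInterval Z 0 T) (hZ' : SatisfiesInChart φ f T u Z)
    (hmem : ∀ t ∈ Icc t₀ s, Z t ∈ φ '' B) :
    ∃ z : ℝ → Eu n, IsFilippovCurve V f u t₀ s z ∧
      ∀ t ∈ Icc t₀ s, ∃ q ∈ B, (q : Eu n) = z t ∧ φ q = Z t := by
  have hBval : IsOpen (Subtype.val '' B) := hV.isOpenMap_subtype_val B hBo
  have hinj : ∀ z ∈ B, ∀ z' ∈ B, φ z = φ z' → z = z' := by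
    intro z hz z' hz' h
    have := hC z hz z' hz'
    rw [h, dist_self, mul_zero] at this
    exact Subtype.ext (dist_le_zero.1 this)
  have hmem' : ∀ t : ℝ, ∃ q : Eu n, t ∈ Icc t₀ s → ∃ h : q ∈ V, ⟨q, h⟩ ∈ B ∧ φ ⟨q, h⟩ = Z t := by
    intro t
    by_cases ht : t ∈ Icc t₀ s
    · obtain ⟨q, hq, hqZ⟩ := hmem t ht
      exact ⟨q, fun _ => ⟨q.2, hq, hqZ⟩⟩
    · exact ⟨0, fun h => absurd h ht⟩
  choose z hz using hmem'
  refine ⟨z, ⟨?_, ?_⟩, fun t ht => ?_⟩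
  · refine (hZ.mono_Icc h0 hs.le hsT).of_dist_le (C := C) ?_
    rw [uIcc_of_le hs.le]
    intro a ha b hb
    obtain ⟨ha1, ha2, ha3⟩ := hz a ha
    obtain ⟨hb1, hb2, hb3⟩ := hz b hb
    rw [← ha3, ← hb3]
    exact hC ⟨z a, ha1⟩ ha2 ⟨z b, hb1⟩ hb2
  · filter_upwards [hZ'] with t h ht
    obtain ⟨ha1, ha2, ha3⟩ := hz t (Ioo_subset_Icc_self ht)
    obtain ⟨w, hw, y, hyt, hlifty, hd⟩ := h ⟨h0.trans_lt ht.1, ht.2.trans_le hsT⟩ _ ha3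
    refine ⟨w, hw, hd.congr_of_eventuallyEq ?_⟩
    -- the lift provided by the velocity stays in the domain of injectivity
    have hyB : ∀ᶠ τ in 𝓝 t, y τ ∈ Subtype.val '' B := by
      refine hd.continuousAt.eventually_mem (hBval.mem_nhds ?_)
      rw [hyt]
      exact ⟨_, ha2, rfl⟩
    filter_upwards [hyB, hlifty, Icc_mem_nhds ht.1 ht.2] with τ h1 h2 h3
    obtain ⟨q, hq, hqy⟩ := h1
    obtain ⟨hyV, hφy⟩ := h2
    obtain ⟨hb1, hb2, hb3⟩ := hz τ h3
    have hq' : q = ⟨y τ, hyV⟩ := Subtype.ext hqy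
    have := hinj _ hb2 q hq (by rw [hb3, hq', hφy])
    rw [← hqy, ← this]
  · obtain ⟨ha1, ha2, ha3⟩ := hz t ht
    exact ⟨_, ha2, rfl, ha3⟩

theorem exists_forall_Icc_mem_of_nhds {M : Type*} [PseudoMetricSpace M] {Z : ℝ → M} {T t₀ : ℝ}
    {S : Set M} (hZ : AbsolutelyContinuousOnInterval Z 0 T) (h0 : 0 ≤ t₀) (hT : t₀ < T)
    (hS : S ∈ 𝓝 (Z t₀)) : ∃ s > t₀, ∀ t ∈ Icc t₀ s, Z t ∈ S := by
  have h1 := hZ.continuousOn_of_pseudoMetric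
  rw [uIcc_of_le (h0.trans hT.le)] at h1
  have hc := (h1 t₀ ⟨h0, hT.le⟩).mono_of_mem_nhdsWithin
    (mem_of_superset (Icc_mem_nhdsGE hT) (Icc_subset_Icc_left h0))
  obtain ⟨s, hs, hsub⟩ := mem_nhdsGE_iff_exists_Icc_subset.1 (hc hS)
  exact ⟨s, hs, hsub⟩

/-- Curves in `M` that satisfy the inclusion in a chart and start at a point of local right
uniqueness agree for a short time. The Lipschitz bound on the coordinates makes the chart injective
near `p` and the lifts absolutely continuous. -/
theorem eqOn_of_satisfiesInChart {n m : ℕ} {M : Type*} [MetricSpace M] {V : Set (Eu n)}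
    {φ : V → M} {f : Eu n → Eu m → Eu n} {u : ℝ → Eu m} {T t₀ : ℝ} {p : V} {X Y : ℝ → M}
    (hV : IsOpen V) (hopen : ∀ W ∈ 𝓝 p, φ '' W ∈ 𝓝 (φ p)) (hφ : LocallyLipschitzCoordinates φ)
    (hlu : LocalRightUniqueness V f u t₀ p) (h0 : 0 ≤ t₀) (hT : t₀ < T)
    (hX : AbsolutelyContinuousOnInterval X 0 T) (hY : AbsolutelyContinuousOnInterval Y 0 T)
    (hXp : X t₀ = φ p) (hYp : Y t₀ = φ p) (hX' : SatisfiesInChart φ f T u X)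
    (hY' : SatisfiesInChart φ f T u Y) :
    ∃ t₁ > t₀, EqOn X Y (Icc t₀ t₁) := by
  obtain ⟨W, hW, C, hC⟩ := hφ p
  obtain ⟨N, hN, t₁, ht₁, huniq⟩ := hlu
  obtain ⟨B, hB, hBo, hpB⟩ := mem_nhds_iff.1
    (inter_mem hW (continuous_subtype_val.continuousAt.preimage_mem_nhds hN))
  have hCB : ∀ x ∈ B, ∀ y ∈ B, dist (x : Eu n) y ≤ C * dist (φ x) (φ y) :=
    fun x hx y hy => hC x (hB hx).1 y (hB hy).1
  have hinj : ∀ z ∈ B, ∀ z' ∈ B, φ z = φ z' → z = z' := by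
    intro z hz z' hz' h
    have := hCB z hz z' hz'
    rw [h, dist_self, mul_zero] at this
    exact Subtype.ext (dist_le_zero.1 this)
  have hS := hopen B (hBo.mem_nhds hpB)
  obtain ⟨s₁, hs₁, hm₁⟩ := exists_forall_Icc_mem_of_nhds hX h0 hT (hXp ▸ hS)
  obtain ⟨s₂, hs₂, hm₂⟩ := exists_forall_Icc_mem_of_nhds hY h0 hT (hYp ▸ hS)
  obtain ⟨s, hs, hss⟩ := exists_between (lt_min (lt_min hs₁ hs₂) (lt_min hT ht₁))
  simp only [lt_min_iff] at hss
  obtain ⟨x, hxF, hx⟩ := exists_isFilippovCurve_lift hV hBo hCB h0 hs hss.2.1.le hX hX'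
    fun t ht => hm₁ t ⟨ht.1, ht.2.trans hss.1.1.le⟩
  obtain ⟨y, hyF, hy⟩ := exists_isFilippovCurve_lift hV hBo hCB h0 hs hss.2.1.le hY hY'
    fun t ht => hm₂ t ⟨ht.1, ht.2.trans hss.1.2.le⟩
  have start : ∀ {z : ℝ → Eu n} {Z : ℝ → M}, Z t₀ = φ p →
      (∀ t ∈ Icc t₀ s, ∃ q ∈ B, (q : Eu n) = z t ∧ φ q = Z t) → z t₀ = p := by
    intro z Z hZ h
    obtain ⟨q, hq, hqz, hqZ⟩ := h t₀ (left_mem_Icc.2 hs.le)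
    rw [← hqz, hinj q hq p hpB (hqZ.trans hZ)]
  have inN : ∀ {z : ℝ → Eu n} {Z : ℝ → M},
      (∀ t ∈ Icc t₀ s, ∃ q ∈ B, (q : Eu n) = z t ∧ φ q = Z t) → ∀ t ∈ Icc t₀ s, z t ∈ N := by
    intro z Z h t ht
    obtain ⟨q, hq, hqz, -⟩ := h t ht
    exact hqz ▸ (hB hq).2
  have heq := huniq s hss.2.2.le x y hxF hyF (inN hx) (inN hy) (start hXp hx) (start hYp hy)
  refine ⟨s, hs, fun t ht => ?_⟩
  obtain ⟨q, -, hqx, hqX⟩ := hx t ht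
  obtain ⟨q', -, hqy, hqY⟩ := hy t ht
  rw [← hqX, ← hqY, Subtype.ext (hqx.trans ((heq ht).trans hqy.symm))]

/-! ### Smooth domains and hypersurfaces along a hyperplane -/

theorem eventually_pos_along {n : ℕ} {k : Eu n → ℝ} {L : Eu n →L[ℝ] ℝ} {p v : Eu n}
    (hk : HasFDerivAt k L p) (h0 : k p = 0) (hv : 0 < L v) :
    ∀ᶠ ρ : ℝ in 𝓝[>] 0, 0 < k (p + ρ • v) := by
  have h1 : HasDerivAt (fun ρ : ℝ => k (p + ρ • v)) (L v) 0 := by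
    have hl : HasDerivAt (fun ρ : ℝ => p + ρ • v) v 0 := by
      simpa using ((hasDerivAt_id (0 : ℝ)).smul_const v).const_add p
    exact HasFDerivAt.comp_hasDerivAt (0 : ℝ) (by simpa using hk) hl
  have h2 := (hasDerivAt_iff_tendsto_slope_zero.1 h1).mono_left
    (nhdsWithin_mono 0 fun x (hx : x ∈ Ioi 0) => (ne_of_gt hx))
  filter_upwards [h2.eventually_const_lt hv, self_mem_nhdsWithin] with ρ h3 h4
  simp only [zero_add, zero_smul, add_zero, h0, sub_zero, smul_eq_mul] at h3
  exact (pos_iff_pos_of_mul_pos h3).1 (inv_pos.2 h4)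

theorem exists_zero_between {n : ℕ} {k : Eu n → ℝ} {B : Set (Eu n)} {a b : Eu n}
    (hk : ContinuousOn k B) (hB : Convex ℝ B) (ha : a ∈ B) (hb : b ∈ B) (hka : k a < 0)
    (hkb : 0 < k b) : ∃ θ : ℝ, a + θ • (b - a) ∈ B ∧ k (a + θ • (b - a)) = 0 := by
  have hsub := hB.segment_subset ha hb
  obtain ⟨z, hz, hz0⟩ := (convex_segment a b).isPreconnected.intermediate_value
    (left_mem_segment ℝ a b) (right_mem_segment ℝ a b) (hk.mono hsub) ⟨hka.le, hkb.le⟩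
  rw [segment_eq_image'] at hz
  obtain ⟨θ, hθ, rfl⟩ := hz
  exact ⟨θ, hsub (by rw [segment_eq_image']; exact ⟨θ, hθ, rfl⟩), hz0⟩

theorem eventually_add_smul_mem {n : ℕ} {W : Set (Eu n)} {p : Eu n} (hW : W ∈ 𝓝 p) (v : Eu n) :
    ∀ᶠ ρ : ℝ in 𝓝[>] 0, p + ρ • v ∈ W := by
  have : Tendsto (fun ρ : ℝ => p + ρ • v) (𝓝 0) (𝓝 p) := by
    have hc : Continuous fun ρ : ℝ => p + ρ • v := by fun_prop
    simpa using hc.tendsto 0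
  exact (this.mono_left nhdsWithin_le_nhds) hW

/-- A smooth hypersurface contained in a hyperplane is relatively open in it. -/
theorem IsSmoothHypersurface.eventually_mem {n : ℕ} {G : Set (Eu n)} (hG : IsSmoothHypersurface G)
    {N : Eu n} {c₀ : ℝ} (hN : ‖N‖ = 1) (hGN : ∀ x ∈ G, inner ℝ N x - c₀ = 0) {p : Eu n}
    (hp : p ∈ G) : ∀ᶠ y in 𝓝 p, inner ℝ N y - c₀ = 0 → y ∈ G := by
  obtain ⟨W, k, hW, hpW, hk, hkp, hk', hGk⟩ := hG p hp
  have hNN : inner ℝ N N = (1 : ℝ) := by rw [real_inner_self_eq_norm_sq, hN]; norm_num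
  obtain ⟨ε, hε, hball⟩ := Metric.isOpen_iff.1 hW p hpW
  have hconv := convex_ball p ε
  have hnhds := Metric.ball_mem_nhds p hε
  have hkc : ContinuousOn k (Metric.ball p ε) := hk.continuousOn.mono hball
  have hd : HasFDerivAt k (fderiv ℝ k p) p :=
    ((hk.contDiffAt (hW.mem_nhds hpW)).differentiableAt (by simp)).hasFDerivAt
  have hd' : HasFDerivAt (fun x => -k x) (-fderiv ℝ k p) p := hd.neg
  set L := fderiv ℝ k p
  have neg_along : ∀ v, L v < 0 → ∀ᶠ ρ : ℝ in 𝓝[>] 0, k (p + ρ • v) < 0 := by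
    intro v hv
    filter_upwards [eventually_pos_along hd' (by simp [hkp]) (v := v) (by simpa using hv)] with ρ h
    linarith
  have pos_along : ∀ v, 0 < L v → ∀ᶠ ρ : ℝ in 𝓝[>] 0, 0 < k (p + ρ • v) :=
    fun v => eventually_pos_along hd hkp
  have hgp := hGN p hp
  -- otherwise `k` would vanish at points off the hyperplane
  have hLN : L N ≠ 0 := by
    intro h0
    obtain ⟨v₀, hv₀⟩ : ∃ v, 0 < L v := by
      by_contra! h
      refine hk' (ContinuousLinearMap.ext fun v => le_antisymm (h v) ?_)
      have := h (-v)
      rw [map_neg] at this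
      simpa using this
    set v := v₀ - (inner ℝ N v₀ : ℝ) • N with hv
    have hLv : 0 < L v := by rw [hv, map_sub, map_smul, h0]; simpa using hv₀
    have hNv : inner ℝ N v = (0 : ℝ) := by
      rw [hv, inner_sub_right, inner_smul_right, hNN]; ring
    obtain ⟨ρ, ⟨⟨⟨h1, h2⟩, h3⟩, h4⟩, hρ⟩ :=
      ((((pos_along (N + v) (by rw [map_add, h0]; linarith)).and
      (neg_along (N - v) (by rw [map_sub, h0]; linarith))).and
      (eventually_add_smul_mem hnhds (N + v))).and
      (eventually_add_smul_mem hnhds (N - v))).and self_mem_nhdsWithin |>.exists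
    obtain ⟨θ, hθB, hθ⟩ := exists_zero_between hkc hconv h4 h3 h2 h1
    have := hGN _ ((hGk _ (hball hθB)).2 hθ)
    simp only [inner_add_right, inner_sub_right, inner_smul_right, hNN, hNv] at this
    have hρ' : (0 : ℝ) < ρ := hρ
    linarith
  -- near `p`, `k` changes sign along the normal line through `y`; its zero there lies in `G`,
  -- hence in the hyperplane, so it is `y` itself
  obtain ⟨σ, hσ⟩ : ∃ σ : ℝ, 0 < L (σ • N) := by
    rcases lt_or_gt_of_ne hLN with h | h
    · exact ⟨-1, by simpa using h⟩
    · exact ⟨1, by simpa using h⟩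
  obtain ⟨ρ, ⟨⟨h1, h2⟩, h3⟩, h4⟩ := (((pos_along (σ • N) hσ).and
    (neg_along (-(σ • N)) (by rw [map_neg]; linarith))).and
    (eventually_add_smul_mem hnhds (σ • N))).and
    (eventually_add_smul_mem hnhds (-(σ • N))) |>.exists
  have near : ∀ v, p + v ∈ Metric.ball p ε →
      ∀ᶠ y in 𝓝 p, y + v ∈ Metric.ball p ε ∧ (0 < k (p + v) → 0 < k (y + v)) ∧
        (k (p + v) < 0 → k (y + v) < 0) := by
    intro v hv
    have ht : Tendsto (fun y => y + v) (𝓝 p) (𝓝 (p + v)) :=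
      (continuous_id.add continuous_const).tendsto p
    have hb := Metric.isOpen_ball.mem_nhds hv
    have hkt := (hkc.continuousAt hb).tendsto.comp ht
    have e1 : ∀ᶠ y in 𝓝 p, 0 < k (p + v) → 0 < k (y + v) := by
      by_cases h : 0 < k (p + v)
      · filter_upwards [hkt.eventually_const_lt h] with y hy _ using hy
      · exact Eventually.of_forall fun y h' => absurd h' h
    have e2 : ∀ᶠ y in 𝓝 p, k (p + v) < 0 → k (y + v) < 0 := by
      by_cases h : k (p + v) < 0
      · filter_upwards [hkt.eventually_lt_const h] with y hy _ using hy
      · exact Eventually.of_forall fun y h' => absurd h' h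
    filter_upwards [ht.eventually hb, e1, e2] with y a b c using ⟨a, b, c⟩
  filter_upwards [near _ h3, near _ h4] with y hy1 hy2 hy
  obtain ⟨θ, hθB, hθ⟩ := exists_zero_between hkc hconv hy2.1 hy1.1 (hy2.2.2 h2) (hy1.2.1 h1)
  have hmem := (hGk _ (hball hθB)).2 hθ
  have e : y + ρ • -(σ • N) + θ • (y + ρ • σ • N - (y + ρ • -(σ • N))) =
      y + (2 * θ * ρ * σ - ρ * σ) • N := by module
  rw [e] at hmem
  have := hGN _ hmem
  rw [inner_add_right, inner_smul_right, hNN] at this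
  have h0 : 2 * θ * ρ * σ - ρ * σ = 0 := by linarith
  rwa [h0, zero_smul, add_zero] at hmem

/-- A smooth domain on one side of a hyperplane which contains a neighbourhood, in the hyperplane,
of a boundary point `p` contains near `p` all points of that side. -/
theorem IsSmoothDomain.eventually_mem {n : ℕ} {D : Set (Eu n)} (hD : IsSmoothDomain D)
    {N : Eu n} {c₀ : ℝ} (hN : ‖N‖ = 1) (hDN : ∀ x ∈ D, inner ℝ N x - c₀ ≤ 0) {p : Eu n}
    (hp : p ∈ D) (hpi : p ∉ interior D) (hp0 : inner ℝ N p - c₀ = 0)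
    (hface : ∀ᶠ y in 𝓝 p, inner ℝ N y - c₀ = 0 → y ∈ D) :
    ∀ᶠ y in 𝓝 p, inner ℝ N y - c₀ ≤ 0 → y ∈ D := by
  obtain ⟨W, h, hW, hpW, hh, hhp, hh', hDh⟩ := (hD p hp).resolve_left hpi
  have hNN : inner ℝ N N = (1 : ℝ) := by rw [real_inner_self_eq_norm_sq, hN]; norm_num
  have hs : HasStrictFDerivAt h (fderiv ℝ h p) p :=
    (hh.contDiffAt (hW.mem_nhds hpW)).hasStrictFDerivAt (by simp)
  have hd' : HasFDerivAt (fun x => -h x) (-fderiv ℝ h p) p := hs.hasFDerivAt.neg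
  set L := fderiv ℝ h p
  -- otherwise `D` would contain points on the wrong side
  have hLN : 0 < L N := by
    by_contra! hle
    obtain ⟨v₀, hv₀⟩ : ∃ v, L v < 0 := by
      by_contra! h
      refine hh' (ContinuousLinearMap.ext fun v => le_antisymm ?_ (h v))
      have := h (-v)
      rw [map_neg] at this
      simpa using this
    set a : ℝ := |inner ℝ N v₀| + 1
    have ha : 0 ≤ a := by positivity
    have hNv : 0 < inner ℝ N (v₀ + a • N) := by
      rw [inner_add_right, inner_smul_right, hNN]
      have := neg_abs_le (inner ℝ N v₀ : ℝ)
      simp only [a]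
      linarith
    have hLv : 0 < (-L) (v₀ + a • N) := by
      simp only [neg_apply, map_add, map_smul, smul_eq_mul]
      nlinarith
    obtain ⟨ρ, ⟨h1, h2⟩, hρ⟩ := ((eventually_pos_along hd' (by simp [hhp]) hLv).and
      (eventually_add_smul_mem (hW.mem_nhds hpW) (v₀ + a • N))).and self_mem_nhdsWithin |>.exists
    have := hDN _ ((hDh _ h2).2 (by linarith))
    rw [inner_add_right, inner_smul_right] at this
    have := mul_pos (show (0 : ℝ) < ρ from hρ) hNv
    linarith
  -- compare `y` with its projection to the hyperplane, which lies in `D`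
  have hproj : Tendsto (fun y => y - (inner ℝ N y - c₀) • N) (𝓝 p) (𝓝 p) := by
    have hc : Continuous fun y : Eu n => y - (inner ℝ N y - c₀) • N := by fun_prop
    simpa [hp0] using hc.tendsto p
  have hpair : Tendsto (fun y => (y, y - (inner ℝ N y - c₀) • N)) (𝓝 p) (𝓝 (p, p)) :=
    tendsto_id.prodMk_nhds hproj
  have hlo := hpair.eventually (hs.isLittleO.def (half_pos hLN))
  filter_upwards [hlo, hproj.eventually hface, hproj.eventually (hW.mem_nhds hpW),
    hW.mem_nhds hpW] with y h1 h2 h3 h4 hy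
  have hz0 : inner ℝ N (y - (inner ℝ N y - c₀) • N) - c₀ = 0 := by
    rw [inner_sub_right, inner_smul_right, hNN]; ring
  have h5 := (hDh _ h3).1 (h2 hz0)
  refine (hDh y h4).2 ?_
  simp only [sub_sub_cancel, map_smul, smul_eq_mul, norm_smul, hN, mul_one] at h1
  rw [Real.norm_of_nonpos hy] at h1
  have h6 := (le_abs_self _).trans h1
  nlinarith

namespace HybridSystem

variable {J : Type*} {n m : ℕ} {H : HybridSystem J n m}

/-! ### The extended reset map -/

theorem g_sub_smul {e : J × J} (hg : ‖H.ghat e‖ = 1) (x : Eu n) :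
    H.g e (x - H.g e x • H.ghat e) = 0 := by
  have hNN : inner ℝ (H.ghat e) (H.ghat e) = (1 : ℝ) := by
    rw [real_inner_self_eq_norm_sq, hg]; norm_num
  simp only [g, inner_sub_right, inner_smul_right, hNN]
  ring

theorem Rbar_eq_of_g_eq_zero {e : J × J} {x : Eu n} (hx : H.g e x = 0) : H.Rbar e x = H.R e x := by
  simp [Rbar, hx]

theorem Standing.r_Rbar (hH : H.Standing) {e : J × J} (he : e ∈ H.Γ) (x : Eu n) :
    H.r e (H.Rbar e x) = H.g e x := by
  have hNN : inner ℝ (H.rhat e) (H.rhat e) = (1 : ℝ) := by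
    rw [real_inner_self_eq_norm_sq, hH.rhat_unit e he]; norm_num
  have h := hH.reset_affine e he _ (g_sub_smul (hH.ghat_unit e he) x)
  simp only [r] at h
  simp only [r, Rbar, inner_add_right, inner_smul_right, hNN]
  linarith

theorem Standing.R_injective (hH : H.Standing) {e : J × J} (he : e ∈ H.Γ) :
    Function.Injective (H.R e) := by
  obtain ⟨-, -, S, hS, -⟩ := hH.reset_diffeo e he
  exact hS.injective

theorem contDiff_g (e : J × J) : ContDiff ℝ ∞ (H.g e) := by
  unfold g
  exact (contDiff_const.inner ℝ contDiff_id).sub contDiff_const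

theorem hasFDerivAt_g (e : J × J) (x : Eu n) :
    HasFDerivAt (H.g e) (innerSL ℝ (H.ghat e)) x :=
  ((innerSL ℝ (H.ghat e)).hasFDerivAt (x := x)).sub_const (H.c e)

theorem hasFDerivAt_r (e : J × J) (x : Eu n) :
    HasFDerivAt (H.r e) (innerSL ℝ (H.rhat e)) x :=
  ((innerSL ℝ (H.rhat e)).hasFDerivAt (x := x)).sub_const (H.d e)

theorem Standing.contDiff_Rbar (hH : H.Standing) {e : J × J} (he : e ∈ H.Γ) :
    ContDiff ℝ ∞ (H.Rbar e) := by
  have h1 := (hH.reset_diffeo e he).1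
  have h2 := contDiff_g (H := H) e
  unfold Rbar
  exact (h1.comp (contDiff_id.sub (h2.smul contDiff_const))).add (h2.smul contDiff_const)

theorem Standing.continuous_Rbar (hH : H.Standing) {e : J × J} (he : e ∈ H.Γ) :
    Continuous (H.Rbar e) := (hH.contDiff_Rbar he).continuous

theorem Standing.hasFDerivAt_Rbar (hH : H.Standing) {e : J × J} (he : e ∈ H.Γ) (x : Eu n) :
    HasFDerivAt (H.Rbar e) (fderiv ℝ (H.Rbar e) x) x :=
  ((hH.contDiff_Rbar he).differentiable (by simp) x).hasFDerivAt

/-- The derivative of `R̄_e` preserves normal components, since `r_e ∘ R̄_e = g_e`. -/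
theorem Standing.inner_rhat_fderiv_Rbar (hH : H.Standing) {e : J × J} (he : e ∈ H.Γ)
    (x v : Eu n) : inner ℝ (H.rhat e) (fderiv ℝ (H.Rbar e) x v) = (inner ℝ (H.ghat e) v : ℝ) := by
  have h1 := (hasFDerivAt_r (H := H) e (H.Rbar e x)).comp x (hH.hasFDerivAt_Rbar he x)
  have h2 : H.r e ∘ H.Rbar e = H.g e := funext (hH.r_Rbar he)
  rw [h2] at h1
  have := congrArg (fun A => A v) (h1.unique (hasFDerivAt_g e x))
  simpa using this

/-- A vector killed by the derivative of `R̄_e` has no normal component, so it is killed by the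
derivative of the diffeomorphism `R_e`. -/
theorem Standing.fderiv_Rbar_injective (hH : H.Standing) {e : J × J} (he : e ∈ H.Γ) (x : Eu n) :
    Function.Injective (fderiv ℝ (H.Rbar e) x) := by
  rw [injective_iff_map_eq_zero]
  intro v hv
  have hgv : inner ℝ (H.ghat e) v = (0 : ℝ) := by
    rw [← hH.inner_rhat_fderiv_Rbar he x v, hv, inner_zero_right]
  obtain ⟨hR, -, S, hS, -, hSd, -⟩ := hH.reset_diffeo e he
  set px := x - H.g e x • H.ghat e
  -- along the tangent direction `v`, the derivatives of `R̄_e` at `x` and of `R_e` at `px` agree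
  have hRd : HasFDerivAt (H.R e) (fderiv ℝ (H.R e) px) px :=
    (hR.differentiable (by simp) px).hasFDerivAt
  have hg := hasFDerivAt_g (H := H) e x
  have h1 : HasFDerivAt (H.Rbar e) _ x :=
    (hRd.comp x ((hasFDerivAt_id x).sub (hg.smul_const (H.ghat e)))).add (hg.smul_const (H.rhat e))
  have h2 : fderiv ℝ (H.R e) px v = 0 := by
    have := congrArg (fun A => A v) ((hH.hasFDerivAt_Rbar he x).unique h1)
    simpa [hv, hgv] using this.symm
  have h3 := ((hSd.differentiable (by simp) (H.R e px)).hasFDerivAt).comp px hRd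
  have h4 : S ∘ H.R e = id := hS.comp_eq_id
  rw [h4] at h3
  have := congrArg (fun A => A v) (h3.unique (hasFDerivAt_id px))
  simpa [h2] using this.symm

theorem Standing.exists_equiv_fderiv_Rbar (hH : H.Standing) {e : J × J} (he : e ∈ H.Γ)
    (x : Eu n) : ∃ A : Eu n ≃L[ℝ] Eu n, (A : Eu n →L[ℝ] Eu n) = fderiv ℝ (H.Rbar e) x := by
  refine ⟨(LinearEquiv.ofInjectiveEndo (fderiv ℝ (H.Rbar e) x : Eu n →ₗ[ℝ] Eu n)
    (hH.fderiv_Rbar_injective he x)).toContinuousLinearEquiv, ?_⟩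
  ext v
  simp

theorem Standing.map_nhds_Rbar (hH : H.Standing) {e : J × J} (he : e ∈ H.Γ) (x : Eu n) :
    map (H.Rbar e) (𝓝 x) = 𝓝 (H.Rbar e x) := by
  obtain ⟨A, hA⟩ := hH.exists_equiv_fderiv_Rbar he x
  have hs : HasStrictFDerivAt (H.Rbar e) (A : Eu n →L[ℝ] Eu n) x := by
    rw [hA]
    exact (hH.contDiff_Rbar he).contDiffAt.hasStrictFDerivAt (by simp)
  exact hs.map_nhds_eq_of_equiv

theorem Standing.isOpenMap_Rbar (hH : H.Standing) {e : J × J} (he : e ∈ H.Γ) :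
    IsOpenMap (H.Rbar e) :=
  IsOpenMap.of_nhds_le fun x => (hH.map_nhds_Rbar he x).ge

/-- The range of `R̄_e` is open, because `R̄_e` is a local diffeomorphism, and closed, because
`R_e` is a homeomorphism of `ℝⁿ`. -/
theorem Standing.Rbar_surjective (hH : H.Standing) {e : J × J} (he : e ∈ H.Γ) :
    Function.Surjective (H.Rbar e) := by
  obtain ⟨hR, -, S, hS, hS', hSd, -⟩ := hH.reset_diffeo e he
  have hrange : range (H.Rbar e) = {y | H.g e (S (y - H.r e y • H.rhat e)) = 0} := by
    ext y
    constructor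
    · rintro ⟨x, rfl⟩
      have : H.Rbar e x - H.r e (H.Rbar e x) • H.rhat e = H.R e (x - H.g e x • H.ghat e) := by
        rw [hH.r_Rbar he]; simp [Rbar]
      change H.g e (S _) = 0
      rw [this, hS]
      exact g_sub_smul (hH.ghat_unit e he) x
    · intro hy
      have hy' : H.g e (S (y - H.r e y • H.rhat e)) = 0 := hy
      have hNN : inner ℝ (H.ghat e) (H.ghat e) = (1 : ℝ) := by
        rw [real_inner_self_eq_norm_sq, hH.ghat_unit e he]; norm_num
      have hg : H.g e (S (y - H.r e y • H.rhat e) + H.r e y • H.ghat e) = H.r e y := by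
        simp only [g] at hy'
        simp only [g, inner_add_right, inner_smul_right, hNN]
        linarith
      refine ⟨S (y - H.r e y • H.rhat e) + H.r e y • H.ghat e, ?_⟩
      simp only [Rbar, hg, add_sub_cancel_right, hS' _, sub_add_cancel]
  have hopen : IsOpen (range (H.Rbar e)) := (hH.isOpenMap_Rbar he).isOpen_range
  have hclosed : IsClosed (range (H.Rbar e)) := by
    rw [hrange]
    have hr : Continuous (H.r e) := by unfold r; fun_prop
    have hS'' := hSd.continuous
    have hg := (contDiff_g (H := H) e).continuous
    exact isClosed_eq (by fun_prop) continuous_const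
  exact range_eq_univ.1 (IsClopen.eq_univ ⟨hclosed, hopen⟩ (range_nonempty _))

/-! ### The edge charts near guards -/

theorem Standing.g_nonpos (hH : H.Standing) {e : J × J} (he : e ∈ H.Γ) {x : Eu n}
    (hx : x ∈ H.D e.1) : H.g e x ≤ 0 := by
  by_cases h : x ∈ H.G e
  · exact (hH.guard_affine e he x h).le
  · exact (hH.guard_side e he x ⟨hx, h⟩).le

theorem Standing.r_nonneg (hH : H.Standing) {e : J × J} (he : e ∈ H.Γ) {x : Eu n}
    (hx : x ∈ H.D e.2) : 0 ≤ H.r e x := by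
  by_cases h : x ∈ H.R e '' H.G e
  · obtain ⟨y, hy, rfl⟩ := h
    exact (hH.reset_affine e he y (hH.guard_affine e he y hy)).ge
  · exact (hH.reset_side e he x ⟨hx, h⟩).le

theorem Standing.g_neg_of_mem_interior (hH : H.Standing) {e : J × J} (he : e ∈ H.Γ) {x : Eu n}
    (hx : x ∈ interior (H.D e.1)) : H.g e x < 0 := by
  refine hH.guard_side e he x ⟨interior_subset hx, fun h => ?_⟩
  exact (H.guard_boundary e he h).2.2 hx

theorem Standing.mem_guard_of_g_eq_zero (hH : H.Standing) {e : J × J} (he : e ∈ H.Γ) {x : Eu n}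
    (hx : x ∈ H.D e.1) (h0 : H.g e x = 0) : x ∈ H.G e := by
  by_contra h
  exact (hH.guard_side e he x ⟨hx, h⟩).ne h0

theorem Standing.g_nonneg_of_mem_attached (hH : H.Standing) {e : J × J} (he : e ∈ H.Γ) {x : Eu n}
    (hx : x ∈ H.attached e) : 0 ≤ H.g e x := by
  rw [← hH.r_Rbar he]
  exact hH.r_nonneg he hx

theorem Standing.notMem_interior_of_attached (hH : H.Standing) {e : J × J} (he : e ∈ H.Γ)
    {x : Eu n} (hx : x ∈ H.attached e) : x ∉ interior (H.D e.1) := fun h =>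
  (hH.g_neg_of_mem_interior he h).not_ge (hH.g_nonneg_of_mem_attached he hx)

theorem Standing.guard_subset_attached (hH : H.Standing) {e : J × J} (he : e ∈ H.Γ) :
    H.G e ⊆ H.attached e := by
  intro x hx
  change H.Rbar e x ∈ H.D e.2
  rw [Rbar_eq_of_g_eq_zero (hH.guard_affine e he x hx)]
  exact (H.reset_boundary e he ⟨x, hx, rfl⟩).1

theorem Standing.eventually_mem_guard (hH : H.Standing) {e : J × J} (he : e ∈ H.Γ) {p : Eu n}
    (hp : p ∈ H.G e) : ∀ᶠ y in 𝓝 p, H.g e y = 0 → y ∈ H.G e :=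
  (H.guard_smooth e he).eventually_mem (hH.ghat_unit e he) (hH.guard_affine e he) hp

/-- Near a guard the open half-space `g_e < 0` lies in the source domain. -/
theorem Standing.eventually_mem_interior_domain (hH : H.Standing) {e : J × J} (he : e ∈ H.Γ)
    {p : Eu n} (hp : p ∈ H.G e) : ∀ᶠ y in 𝓝 p, H.g e y < 0 → y ∈ interior (H.D e.1) := by
  have hb := H.guard_boundary e he hp
  have h := (H.domain_smooth e.1).eventually_mem (hH.ghat_unit e he)
    (fun x hx => hH.g_nonpos he hx) hb.1 hb.2.2 (hH.guard_affine e he p hp)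
    ((hH.eventually_mem_guard he hp).mono fun y hy h0 => (H.guard_boundary e he (hy h0)).1)
  filter_upwards [h.eventually_nhds] with y hy hneg
  rw [mem_interior_iff_mem_nhds]
  filter_upwards [hy, (contDiff_g e).continuous.continuousAt.eventually_lt_const hneg] with z h1 h2
  exact h1 h2.le

/-- Near a guard the open half-space `g_e > 0` lies in the attached domain. -/
theorem Standing.eventually_mem_interior_attached (hH : H.Standing) {e : J × J} (he : e ∈ H.Γ)
    {p : Eu n} (hp : p ∈ H.G e) : ∀ᶠ y in 𝓝 p, 0 < H.g e y → y ∈ interior (H.attached e) := by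
  have hg0 := hH.guard_affine e he p hp
  have hRp := Rbar_eq_of_g_eq_zero hg0
  have hq : H.Rbar e p ∈ mfdBoundary (H.D e.2) := by
    rw [hRp]; exact H.reset_boundary e he ⟨p, hp, rfl⟩
  have er : ∀ y, inner ℝ (-H.rhat e) y - -H.d e = -H.r e y := fun y => by
    rw [r, inner_neg_left]; ring
  have h := (H.domain_smooth e.2).eventually_mem (N := -H.rhat e) (c₀ := -H.d e)
    (by rw [norm_neg, hH.rhat_unit e he])
    (fun x hx => by rw [er]; linarith [hH.r_nonneg he hx]) hq.1 hq.2.2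
    (by rw [er, hH.r_Rbar he, hg0, neg_zero]) (by
      rw [← hH.map_nhds_Rbar he, eventually_map]
      filter_upwards [hH.eventually_mem_guard he hp] with y hy h0
      rw [er, hH.r_Rbar he] at h0
      exact hH.guard_subset_attached he (hy (by linarith)))
  rw [← hH.map_nhds_Rbar he, eventually_map] at h
  filter_upwards [h.eventually_nhds] with y hy hpos
  rw [mem_interior_iff_mem_nhds]
  filter_upwards [hy, (contDiff_g e).continuous.continuousAt.eventually_const_lt hpos] with z h1 h2
  exact h1 (by rw [er, hH.r_Rbar he]; linarith)

theorem Standing.isOpen_edgeDomain (hH : H.Standing) {e : J × J} (he : e ∈ H.Γ) :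
    IsOpen (H.edgeDomain e) := by
  rw [isOpen_iff_mem_nhds]
  rintro p ((hp | hp) | hp)
  · exact mem_of_superset (isOpen_interior.mem_nhds hp) fun x hx => Or.inl (Or.inl hx)
  · filter_upwards [hH.eventually_mem_guard he hp, hH.eventually_mem_interior_domain he hp,
      hH.eventually_mem_interior_attached he hp] with y h1 h2 h3
    rcases lt_trichotomy (H.g e y) 0 with h | h | h
    · exact Or.inl (Or.inl (h2 h))
    · exact Or.inl (Or.inr (h1 h))
    · exact Or.inr (h3 h)
  · exact mem_of_superset (isOpen_interior.mem_nhds hp) fun x hx => Or.inr hx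

/-! ### The vector field in an edge chart -/

/-- The field of the target mode of the edge `e`, pulled back by `R̄_e`. -/
noncomputable def pullbackField (H : HybridSystem J n m) (e : J × J) (x : Eu n) (v : Eu m) :
    Eu n :=
  (fderiv ℝ (H.Rbar e) x).inverse (H.f e.2 (H.Rbar e x) v)

theorem edgeField_of_mem_interior {e : J × J} {x : Eu n} (hx : x ∈ interior (H.D e.1))
    (v : Eu m) : H.edgeField e x v = H.f e.1 x v := if_pos hx

theorem Standing.edgeField_of_mem_attached (hH : H.Standing) {e : J × J} (he : e ∈ H.Γ) {x : Eu n}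
    (hx : x ∈ interior (H.attached e)) (v : Eu m) :
    H.edgeField e x v = H.pullbackField e x v := by
  rw [edgeField, if_neg (hH.notMem_interior_of_attached he (interior_subset hx)), if_pos hx]
  rfl

/-- The normal component of the pulled back field, as it enters the transversality condition. -/
theorem Standing.inner_ghat_pullbackField (hH : H.Standing) {e : J × J} (he : e ∈ H.Γ)
    (x : Eu n) (v : Eu m) : inner ℝ (H.ghat e) (H.pullbackField e x v) =
      (inner ℝ (H.rhat e) (H.f e.2 (H.Rbar e x) v) : ℝ) := by
  obtain ⟨A, hA⟩ := hH.exists_equiv_fderiv_Rbar he x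
  rw [← hH.inner_rhat_fderiv_Rbar he x, pullbackField, ← hA, ContinuousLinearMap.inverse_equiv]
  simp

theorem Standing.isRegularFieldAt (hH : H.Standing) (j : J) (p : Eu n) {v₀ : Eu m}
    (hv₀ : v₀ ∈ H.U) : IsRegularFieldAt H.U (H.f j) p v₀ := by
  refine ⟨?_, ?_⟩
  · obtain ⟨K, hK⟩ := hH.field_lipschitz j
    refine ⟨K, univ, univ_mem, ?_⟩
    filter_upwards [self_mem_nhdsWithin] with v hv
    exact (hK v hv).lipschitzOnWith
  · have := (hH.field_smooth j).continuousOn (p, v₀) ⟨mem_univ _, hv₀⟩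
    rwa [ContinuousWithinAt, nhdsWithin_prod_eq, nhdsWithin_univ] at this

theorem Standing.isRegularFieldAt_pullbackField (hH : H.Standing) {e : J × J} (he : e ∈ H.Γ)
    (p : Eu n) {v₀ : Eu m} (hv₀ : v₀ ∈ H.U) : IsRegularFieldAt H.U (H.pullbackField e) p v₀ := by
  have hf := hH.isRegularFieldAt e.2 (H.Rbar e p) hv₀
  have hb : Tendsto (fun q : Eu n × Eu m => H.f e.2 (H.Rbar e q.1) q.2) (𝓝 p ×ˢ 𝓝[H.U] v₀)
      (𝓝 (H.f e.2 (H.Rbar e p) v₀)) :=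
    hf.continuous.comp (((hH.continuous_Rbar he).tendsto p).prodMap tendsto_id)
  set A : Eu n → (Eu n →L[ℝ] Eu n) := fun x => (fderiv ℝ (H.Rbar e) x).inverse with hA
  have hA1 : ContDiffAt ℝ 1 A p := by
    obtain ⟨A₀, hA₀⟩ := hH.exists_equiv_fderiv_Rbar he p
    have h1 : ContDiffAt ℝ 1 (fderiv ℝ (H.Rbar e)) p :=
      ((hH.contDiff_Rbar he).fderiv_right (m := 1) (by norm_cast)).contDiffAt
    have h2 : ContDiffAt ℝ 1 ContinuousLinearMap.inverse (fderiv ℝ (H.Rbar e) p) :=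
      hA₀ ▸ contDiffAt_map_inverse A₀
    exact h2.comp p h1
  have hAc : ContinuousAt A p := hA1.continuousAt
  refine ⟨?_, ?_⟩
  · obtain ⟨K₁, hK₁⟩ := hH.field_lipschitz e.2
    obtain ⟨K₂, N₂, hN₂, hK₂⟩ := ((hH.contDiff_Rbar he).contDiffAt (x := p)
      |>.of_le (m := 1) (by norm_cast)).exists_lipschitzOnWith
    obtain ⟨K₃, N₃, hN₃, hK₃⟩ := hA1.exists_lipschitzOnWith
    have hMA := hAc.norm.eventually_lt_const (lt_add_one ‖A p‖)
    have hMb := hb.norm.eventually_lt_const (lt_add_one _)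
    set MA := ‖A p‖ + 1
    set Mb := ‖H.f e.2 (H.Rbar e p) v₀‖ + 1
    obtain ⟨pa, ha, pb, hpb, hab⟩ := eventually_prod_iff.1 hMb
    refine ⟨(K₃ * Mb + MA * (K₁ * K₂)).toNNReal, _,
      inter_mem (inter_mem hN₂ hN₃) (inter_mem hMA ha), ?_⟩
    filter_upwards [hpb, self_mem_nhdsWithin] with v hv hvU
    refine LipschitzOnWith.of_dist_le' fun x hx y hy => ?_
    have h1 : ‖A x - A y‖ ≤ K₃ * dist x y := by
      rw [← dist_eq_norm]; exact hK₃.dist_le_mul x hx.1.2 y hy.1.2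
    have h2 : ‖H.f e.2 (H.Rbar e x) v - H.f e.2 (H.Rbar e y) v‖ ≤ K₁ * K₂ * dist x y := by
      rw [← dist_eq_norm, mul_assoc]
      exact ((hK₁ v hvU).dist_le_mul _ _).trans
        (mul_le_mul_of_nonneg_left (hK₂.dist_le_mul x hx.1.1 y hy.1.1) K₁.2)
    have h3 : ‖H.f e.2 (H.Rbar e x) v‖ ≤ Mb := (hab hx.2.2 hv).le
    have h4 : ‖A y‖ ≤ MA := hy.2.1.le
    have hMA0 : 0 ≤ MA := by positivity
    have hd := dist_nonneg (x := x) (y := y)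
    rw [dist_eq_norm]
    change ‖A x _ - A y _‖ ≤ _
    have e1 : A x (H.f e.2 (H.Rbar e x) v) - A y (H.f e.2 (H.Rbar e y) v) =
        (A x - A y) (H.f e.2 (H.Rbar e x) v) +
          A y (H.f e.2 (H.Rbar e x) v - H.f e.2 (H.Rbar e y) v) := by
      simp
    rw [e1]
    calc _ ≤ ‖A x - A y‖ * ‖H.f e.2 (H.Rbar e x) v‖ +
          ‖A y‖ * ‖H.f e.2 (H.Rbar e x) v - H.f e.2 (H.Rbar e y) v‖ :=
        (norm_add_le _ _).trans (add_le_add (ContinuousLinearMap.le_opNorm _ _)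
          (ContinuousLinearMap.le_opNorm _ _))
      _ ≤ K₃ * dist x y * Mb + MA * (K₁ * K₂ * dist x y) := by gcongr
      _ = _ := by ring
  · exact (isBoundedBilinearMap_apply.continuous.tendsto _).comp
      ((hAc.tendsto.comp tendsto_fst).prodMk_nhds hb)

/-- Local right uniqueness in the edge charts. Only points of the guard need the transversality
condition; elsewhere the field is Lipschitz. -/
theorem Standing.localRightUniqueness_edge (hH : H.Standing) (hT : H.Transverse) {e : J × J}
    (he : e ∈ H.Γ) {u : ℝ → Eu m} {t₀ : ℝ} {v₀ : Eu m} (hv₀ : v₀ ∈ H.U)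
    (hu : Tendsto u (𝓝[>] t₀) (𝓝[H.U] v₀)) {p : Eu n} (hp : p ∈ H.edgeDomain e) :
    LocalRightUniqueness (H.edgeDomain e) (H.edgeField e) u t₀ p := by
  have hQ := hH.isRegularFieldAt e.1 p hv₀
  have hP := hH.isRegularFieldAt_pullbackField he p hv₀
  rcases hp with (hp | hp) | hp
  · refine localRightUniqueness_of_regular hu hQ ?_
    filter_upwards [isOpen_interior.mem_nhds hp] with y hy v
    exact edgeField_of_mem_interior hy v
  · refine localRightUniqueness_of_transverse hu hP hQ (hH.ghat_unit e he)
      (hH.guard_affine e he p hp) ?_ ?_ ?_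
    · filter_upwards [hH.eventually_mem_interior_attached he hp] with y hy v hpos
      exact hH.edgeField_of_mem_attached he (hy hpos) v
    · filter_upwards [hH.eventually_mem_interior_domain he hp] with y hy v hneg
      exact edgeField_of_mem_interior (hy hneg) v
    · rw [hH.inner_ghat_pullbackField he, Rbar_eq_of_g_eq_zero (hH.guard_affine e he p hp)]
      exact hT e he p hp v₀ hv₀
  · refine localRightUniqueness_of_regular hu hP ?_
    filter_upwards [isOpen_interior.mem_nhds hp] with y hy v
    exact hH.edgeField_of_mem_attached he hy v

/-! ### The charts are open maps -/

theorem modeMap_eq_of_mem_guard {e : J × J} (he : e ∈ H.Γ) {x : Eu n} (hx : x ∈ H.G e)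
    (h1 : x ∈ H.D e.1) (h2 : H.R e x ∈ H.D e.2) :
    H.modeMap e.1 ⟨x, h1⟩ = H.modeMap e.2 ⟨H.R e x, h2⟩ :=
  Quot.sound ⟨e, he, rfl, rfl, hx, rfl⟩

/-- On the attached domain, the guard included, `π_e` equals `π_{j'} ∘ R̄_e`. -/
theorem Standing.edgeMap_of_mem_attached (hH : H.Standing) (e : ↥H.Γ) {x : Eu n}
    (hx : x ∈ H.edgeDomain e) (ha : H.Rbar e x ∈ H.D e.1.2) :
    H.edgeMap e ⟨x, hx⟩ = H.modeMap e.1.2 ⟨H.Rbar e x, ha⟩ := by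
  by_cases hD : x ∈ H.D e.1.1
  · have h0 : H.g e x = 0 := le_antisymm (hH.g_nonpos e.2 hD) (hH.g_nonneg_of_mem_attached e.2 ha)
    have hG := hH.mem_guard_of_g_eq_zero e.2 hD h0
    have hR := Rbar_eq_of_g_eq_zero h0
    rw [edgeMap, dif_pos hD, modeMap_eq_of_mem_guard e.2 hG hD (hR ▸ ha)]
    congr 2
    exact hR.symm
  · rw [edgeMap, dif_neg hD]

/-- A set of the disjoint union that is open and invariant under the gluing has open image in the
quotient. -/
theorem mem_nhds_of_glue_invariant {A : Set (Σ j, ↥(H.D j))} (hopen : IsOpen A)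
    (hA : ∀ a b, H.Glue a b → (a ∈ A ↔ b ∈ A)) {S : Set H.Space}
    (hS : ∀ b ∈ A, Quot.mk H.Glue b ∈ S) {a : Σ j, ↥(H.D j)} (ha : a ∈ A) :
    S ∈ @nhds _ H.quotientTopology (Quot.mk H.Glue a) := by
  let _ := H.quotientTopology
  let B : Set H.Space := {z | Quot.lift (· ∈ A) (fun a b h => propext (hA a b h)) z}
  have hB : IsOpen B := isOpen_coinduced.2 hopen
  refine mem_of_superset (hB.mem_nhds (show Quot.mk H.Glue a ∈ B from ha)) ?_
  intro z hz
  induction z using Quot.ind with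
  | mk b => exact hS b hz

theorem Standing.g_pos_of_mem_interior_attached (hH : H.Standing) {e : J × J} (he : e ∈ H.Γ)
    {x : Eu n} (hx : x ∈ interior (H.attached e)) : 0 < H.g e x := by
  have hNN : inner ℝ (H.ghat e) (H.ghat e) = (1 : ℝ) := by
    rw [real_inner_self_eq_norm_sq, hH.ghat_unit e he]; norm_num
  obtain ⟨ρ, h1, h2⟩ := ((eventually_add_smul_mem (mem_interior_iff_mem_nhds.1 hx)
    (-H.ghat e)).and self_mem_nhdsWithin).exists
  have h3 := hH.g_nonneg_of_mem_attached he h1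
  have h4 : (0 : ℝ) < ρ := h2
  simp only [g, inner_add_right, inner_smul_right, inner_neg_right, hNN] at h3
  simp only [g]
  linarith

/-- Within the domain of the chart of `e`, the boundary of the source domain is the guard of `e`. -/
theorem Standing.mem_guard_of_mem_mfdBoundary (hH : H.Standing) {e : J × J} (he : e ∈ H.Γ)
    {x : Eu n} (hx : x ∈ H.edgeDomain e) (hb : x ∈ mfdBoundary (H.D e.1)) : x ∈ H.G e := by
  rcases hx with (h | h) | h
  · exact absurd h hb.2.2
  · exact h
  · exact absurd (hH.g_nonpos he hb.1) (hH.g_pos_of_mem_interior_attached he h).not_ge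

/-- Within the domain of the chart of `e`, only points of the guard of `e` are mapped to the
boundary of the target domain. -/
theorem Standing.mem_guard_of_Rbar_mem_mfdBoundary (hH : H.Standing) {e : J × J} (he : e ∈ H.Γ)
    {x : Eu n} (hx : x ∈ H.edgeDomain e) (hb : H.Rbar e x ∈ mfdBoundary (H.D e.2)) :
    x ∈ H.G e := by
  rcases hx with (h | h) | h
  · exact absurd (hH.g_nonneg_of_mem_attached he hb.1) (hH.g_neg_of_mem_interior he h).not_ge
  · exact h
  · refine absurd ?_ hb.2.2
    exact interior_maximal (image_subset_iff.2 interior_subset)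
      (hH.isOpenMap_Rbar he _ isOpen_interior) ⟨x, h, rfl⟩

/-- The points of the disjoint union represented, in either mode of the edge `e`, by the points of
a set `N` of coordinates: this set is invariant under the gluing. -/
theorem Standing.glue_invariant (hH : H.Standing) {e : J × J} (he : e ∈ H.Γ) {N : Set (Eu n)}
    (hN : N ⊆ H.edgeDomain e) {a b : Σ j, ↥(H.D j)} (hab : H.Glue a b) :
    ((a.1 = e.1 ∧ (a.2 : Eu n) ∈ N) ∨ (a.1 = e.2 ∧ (a.2 : Eu n) ∈ H.Rbar e '' N)) ↔
      ((b.1 = e.1 ∧ (b.2 : Eu n) ∈ N) ∨ (b.1 = e.2 ∧ (b.2 : Eu n) ∈ H.Rbar e '' N)) := by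
  obtain ⟨e', he', ha1, hb1, haG, hbR⟩ := hab
  have haB := H.guard_boundary e' he' haG
  have hbI : (b.2 : Eu n) ∈ H.R e' '' H.G e' := ⟨_, haG, hbR.symm⟩
  have hbB := H.reset_boundary e' he' hbI
  have hRG : ∀ z ∈ H.G e, H.Rbar e z = H.R e z := fun z hz =>
    Rbar_eq_of_g_eq_zero (hH.guard_affine e he z hz)
  constructor
  · rintro (⟨h1, h2⟩ | ⟨h1, z, hz, hzx⟩)
    · have hG := hH.mem_guard_of_mem_mfdBoundary he (hN h2)
        (by rwa [← ha1.symm.trans h1])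
      have hee : e = e' := by
        by_contra hne
        exact disjoint_left.1 (hH.guards_disjoint e he e' he' hne (h1.symm.trans ha1)) hG haG
      subst hee
      exact Or.inr ⟨hb1, _, h2, by rw [hbR, hRG _ hG]⟩
    · have hG := hH.mem_guard_of_Rbar_mem_mfdBoundary he (hN hz)
        (by rwa [hzx, ← ha1.symm.trans h1])
      refine absurd (⟨z, hG, ?_⟩ : (a.2 : Eu n) ∈ H.R e '' H.G e)
        (disjoint_left.1 (hH.guard_image_disjoint e' he' e he (ha1.symm.trans h1)) haG)
      rw [← hzx, hRG z hG]
  · rintro (⟨h1, h2⟩ | ⟨h1, z, hz, hzx⟩)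
    · have hG := hH.mem_guard_of_mem_mfdBoundary he (hN h2)
        (by rwa [← hb1.symm.trans h1])
      exact absurd hbI
        (disjoint_left.1 (hH.guard_image_disjoint e he e' he' (h1.symm.trans hb1)) hG)
    · have hG := hH.mem_guard_of_Rbar_mem_mfdBoundary he (hN hz)
        (by rwa [hzx, ← hb1.symm.trans h1])
      rw [hRG z hG] at hzx
      have hee : e = e' := by
        by_contra hne
        exact disjoint_left.1 (hH.images_disjoint e he e' he' hne (h1.symm.trans hb1))
          ⟨z, hG, hzx⟩ hbI
      subst hee
      have hza : z = a.2 := hH.R_injective he (hzx.trans hbR)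
      exact Or.inl ⟨ha1, hza ▸ hz⟩

/-- The edge charts are open maps for the quotient topology. -/
theorem Standing.edgeMap_image_mem_nhds (hH : H.Standing) (e : ↥H.Γ)
    (p : ↥(H.edgeDomain e)) {W : Set ↥(H.edgeDomain e)} (hW : W ∈ 𝓝 p) :
    H.edgeMap e '' W ∈ @nhds _ H.quotientTopology (H.edgeMap e p) := by
  obtain ⟨B, hBW, hBo, hpB⟩ := mem_nhds_iff.1 hW
  set N : Set (Eu n) := Subtype.val '' B
  have hN : IsOpen N := (hH.isOpen_edgeDomain e.2).isOpenMap_subtype_val B hBo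
  have hRN : IsOpen (H.Rbar e '' N) := hH.isOpenMap_Rbar e.2 N hN
  have hNdom : N ⊆ H.edgeDomain e := by
    rintro _ ⟨q, -, rfl⟩
    exact q.2
  let A : Set (Σ j, ↥(H.D j)) := {a | (a.1 = e.1.1 ∧ (a.2 : Eu n) ∈ N) ∨
    (a.1 = e.1.2 ∧ (a.2 : Eu n) ∈ H.Rbar e '' N)}
  have hAo : IsOpen A := by
    refine isOpen_sigma_iff.2 fun k => ?_
    have h1 : IsOpen {x : ↥(H.D k) | k = e.1.1 ∧ (x : Eu n) ∈ N} :=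
      isOpen_const.inter (hN.preimage continuous_subtype_val)
    have h2 : IsOpen {x : ↥(H.D k) | k = e.1.2 ∧ (x : Eu n) ∈ H.Rbar e '' N} :=
      isOpen_const.inter (hRN.preimage continuous_subtype_val)
    exact h1.union h2
  have hS : ∀ b ∈ A, Quot.mk H.Glue b ∈ H.edgeMap e '' W := by
    rintro ⟨k, x, hx⟩ (⟨rfl, q, hq, hqx⟩ | ⟨rfl, _, ⟨q, hq, rfl⟩, hqx⟩)
    · obtain rfl : (q : Eu n) = x := hqx
      refine ⟨q, hBW hq, ?_⟩
      rw [edgeMap, dif_pos hx]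
      rfl
    · obtain rfl : H.Rbar e q = x := hqx
      exact ⟨q, hBW hq, hH.edgeMap_of_mem_attached e q.2 hx⟩
  have hpN : (p : Eu n) ∈ N := ⟨p, hpB, rfl⟩
  by_cases hD : (p : Eu n) ∈ H.D e.1.1
  · rw [edgeMap, dif_pos hD]
    exact mem_nhds_of_glue_invariant hAo (fun a b => hH.glue_invariant e.2 hNdom) hS
      (a := ⟨_, _, hD⟩) (Or.inl ⟨rfl, hpN⟩)
  · rw [edgeMap, dif_neg hD]
    exact mem_nhds_of_glue_invariant hAo (fun a b => hH.glue_invariant e.2 hNdom) hS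
      (a := ⟨_, _, H.mem_of_mem_edgeDomain e p.2 hD⟩) (Or.inr ⟨rfl, _, hpN, rfl⟩)

theorem Isolated.modeMap_image_mem_nhds {j : J} (hj : H.Isolated j) (p : ↥(H.D j))
    {W : Set ↥(H.D j)} (hW : W ∈ 𝓝 p) :
    H.modeMap j '' W ∈ @nhds _ H.quotientTopology (H.modeMap j p) := by
  obtain ⟨B, hBW, hBo, hpB⟩ := mem_nhds_iff.1 hW
  refine mem_nhds_of_glue_invariant
    (isOpenMap_sigmaMk (σ := fun j => ↥(H.D j)) (i := j) B hBo) ?_ ?_ ⟨p, hpB, rfl⟩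
  · rintro a b ⟨e, he, ha, hb, -⟩
    constructor
    · rintro ⟨q, -, rfl⟩
      exact absurd ha.symm (hj e he).1
    · rintro ⟨q, -, rfl⟩
      exact absurd hb.symm (hj e he).2
  · rintro _ ⟨q, hq, rfl⟩
    exact ⟨q, hBW hq, rfl⟩

/-- The domain of an isolated mode has no boundary points, since those would lie in guards or in
images of guards. -/
theorem Standing.isOpen_of_isolated (hH : H.Standing) {j : J} (hj : H.Isolated j) :
    IsOpen (H.D j) := by
  rw [← subset_interior_iff_isOpen]
  intro x hx
  by_contra hi
  obtain ⟨e, he, h | h⟩ := hH.boundary_covered j x ⟨hx, subset_closure hx, hi⟩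
  · exact (hj e he).1 h.1
  · exact (hj e he).2 h.1

/-- The edge charts and the charts of the isolated modes cover the quotient. -/
theorem Standing.exists_chart (hH : H.Standing) (z : H.Space) :
    (∃ (e : ↥H.Γ) (p : ↥(H.edgeDomain e)), z = H.edgeMap e p) ∨
      ∃ (j : J) (_ : H.Isolated j) (p : ↥(H.D j)), z = H.modeMap j p := by
  induction z using Quot.ind with
  | mk a =>
  obtain ⟨k, x, hx⟩ := a
  by_cases hk : H.Isolated k
  · exact Or.inr ⟨k, hk, ⟨x, hx⟩, rfl⟩
  left
  by_cases hi : x ∈ interior (H.D k)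
  · simp only [Isolated, not_forall] at hk
    obtain ⟨e, he, hk⟩ := hk
    by_cases h1 : e.1 = k
    · subst h1
      refine ⟨⟨e, he⟩, ⟨x, Or.inl (Or.inl hi)⟩, ?_⟩
      rw [edgeMap, dif_pos hx]
      rfl
    · obtain rfl : e.2 = k := by
        by_contra h2
        exact hk ⟨h1, h2⟩
      obtain ⟨y, rfl⟩ := hH.Rbar_surjective he x
      have hy : y ∈ interior (H.attached e) :=
        preimage_interior_subset_interior_preimage (hH.continuous_Rbar he) hi
      exact ⟨⟨e, he⟩, ⟨y, Or.inr hy⟩, (hH.edgeMap_of_mem_attached ⟨e, he⟩ _ hx).symm⟩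
  · obtain ⟨e, he, ⟨rfl, hG⟩ | ⟨rfl, y, hG, rfl⟩⟩ :=
      hH.boundary_covered k x ⟨hx, subset_closure hx, hi⟩
    · refine ⟨⟨e, he⟩, ⟨x, Or.inl (Or.inr hG)⟩, ?_⟩
      rw [edgeMap, dif_pos hx]
      rfl
    · have hR := Rbar_eq_of_g_eq_zero (hH.guard_affine e he y hG)
      refine ⟨⟨e, he⟩, ⟨y, Or.inl (Or.inr hG)⟩, Eq.trans ?_
        (hH.edgeMap_of_mem_attached ⟨e, he⟩ (Or.inl (Or.inr hG)) (hR ▸ hx)).symm⟩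
      change H.modeMap e.2 ⟨H.R e y, hx⟩ = _
      congr 2
      exact hR.symm

/-! ### Uniqueness of hybrid Filippov solutions -/

theorem exists_tendsto_input {T : ℝ} {u : ℝ → Eu m} (hU : IsCompact H.U)
    (hu : IsPiecewiseContinuous T H.U u) {t₀ : ℝ} (ht₀ : t₀ ∈ Ico 0 T) :
    ∃ v₀ ∈ H.U, Tendsto u (𝓝[>] t₀) (𝓝[H.U] v₀) := by
  obtain ⟨v₀, hv₀⟩ := hu.right_limit t₀ ht₀
  have hmem : ∀ᶠ t in 𝓝[>] t₀, u t ∈ H.U := by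
    filter_upwards [Ioo_mem_nhdsGT ht₀.2] with t ht
    exact hu.mem t ⟨ht₀.1.trans ht.1.le, ht.2.le⟩
  exact ⟨v₀, hU.isClosed.mem_of_tendsto hv₀ hmem, tendsto_nhdsWithin_iff.2 ⟨hv₀, hmem⟩⟩

/-- Two solutions that agree at a time `t₀ < T` agree for some time after `t₀`. -/
theorem Standing.exists_eqOn_Icc (hH : H.Standing) (hT : H.Transverse) [MetricSpace H.Space]
    (hd : H.IsStateMetric) {T : ℝ} {X₀ : H.Space} {u : ℝ → Eu m}
    (hu : IsPiecewiseContinuous T H.U u) {X Y : ℝ → H.Space}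
    (hX : H.IsFilippovSolution T X₀ u X) (hY : H.IsFilippovSolution T X₀ u Y) {t₀ : ℝ}
    (ht₀ : t₀ ∈ Ico 0 T) (hXY : X t₀ = Y t₀) : ∃ t₁ > t₀, EqOn X Y (Icc t₀ t₁) := by
  obtain ⟨v₀, hv₀, hlim⟩ := exists_tendsto_input H.inputs_compact hu ht₀
  have htop : ∀ z : H.Space, 𝓝 z = @nhds _ H.quotientTopology z := fun z => by
    rw [hd.topology_eq]
  rcases hH.exists_chart (X t₀) with ⟨e, p, hp⟩ | ⟨j, hj, p, hp⟩
  · exact eqOn_of_satisfiesInChart (hH.isOpen_edgeDomain e.2)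
      (fun W hW => htop _ ▸ hH.edgeMap_image_mem_nhds e p hW) (hd.edge_coordinates e)
      (hH.localRightUniqueness_edge hT e.2 hv₀ hlim p.2) ht₀.1 ht₀.2 hX.absolutelyContinuous
      hY.absolutelyContinuous hp (hXY ▸ hp) (hX.inclusion e) (hY.inclusion e)
  · exact eqOn_of_satisfiesInChart (hH.isOpen_of_isolated hj)
      (fun W hW => htop _ ▸ hj.modeMap_image_mem_nhds p hW) (hd.mode_coordinates j hj)
      (localRightUniqueness_of_regular hlim (hH.isRegularFieldAt j p hv₀)
        (Eventually.of_forall fun _ _ => rfl)) ht₀.1 ht₀.2 hX.absolutelyContinuous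
      hY.absolutelyContinuous hp (hXY ▸ hp) (hX.inclusion_isolated j hj)
      (hY.inclusion_isolated j hj)

end HybridSystem

theorem mainTheorem3 {J : Type*} [Finite J] {n m : ℕ} (H : HybridSystem J n m)
    (hH : H.Standing) (hT : H.Transverse)
    [MetricSpace H.Space] (hd : H.IsStateMetric)
    (T : ℝ) (T_nonneg : 0 ≤ T) (X₀ : H.Space) (u : ℝ → Eu m)
    (hu : IsPiecewiseContinuous T H.U u)
    (X : ℝ → H.Space) (hX : H.IsFilippovSolution T X₀ u X) :
    ∀ Y : ℝ → H.Space, H.IsFilippovSolution T X₀ u Y → ∀ t ∈ Icc 0 T, Y t = X t := by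
  intro Y hY
  have hXc := hX.absolutelyContinuous.continuousOn_of_pseudoMetric
  have hYc := hY.absolutelyContinuous.continuousOn_of_pseudoMetric
  rw [uIcc_of_le T_nonneg] at hXc hYc
  have hclosed : IsClosed ({t | Y t = X t} ∩ Icc 0 T) := by
    have := (continuous_dist.comp_continuousOn (hYc.prodMk hXc)).preimage_isClosed_of_isClosed
      isClosed_Icc (isClosed_singleton (x := 0))
    convert this using 1
    ext t
    simp [and_comm]
  refine hclosed.Icc_subset_of_forall_exists_gt (hY.initial.trans hX.initial.symm) ?_
  rintro t ⟨ht, htI⟩ s hs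
  obtain ⟨t₁, ht₁, heq⟩ := hH.exists_eqOn_Icc hT hd hu hY hX htI ht
  have h1 : t < min s t₁ := lt_min hs ht₁
  exact ⟨min s t₁, heq ⟨h1.le, min_le_right _ _⟩, h1, min_le_left _ _⟩
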